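/- **Notation.** For a sequence $(a_n)$ write $a_n\approx\sum_{k\ge 0}f_k(n)$ if, as $n\to\infty$, $a_n=\sum_{k=0}^{r}f_k(n)+O(f_{r+1}(n))$ for every $r\ge 0$ and $f_{k+1}(n)=o(f_k(n))$ for every $k\ge 0$. Put $(-1)!!=1$. **Models.** All objects are labeled, and objects of a given size are chosen uniformly at random. - A *triangulated* (resp. *quadrangulated*) *surface* is obtained from labeled oriented triangles (resp. quadrilaterals), whose sides are distinguishable, by choosing a perfect matching of the set of all sides and identifying matched sides with opposite orientations. - A *quadratic square-tiled surface* is obtained in the same way from labeled squares, each with two horizontal and two vertical sides, where horizontal sides are matched with horizontal sides and vertical sides with vertical sides. - A *GEM of dimension $3$* is obtained from labeled tetrahedra with vertices colored $1,2,3,4$ by choosing, for each color $c$, a perfect matching $\alpha_c$ of the set of tetrahedra and gluing the face of the tetrahedron $i$ opposite to its vertex of color $c$ to the face of the tetrahedron $\alpha_c(i)$ opposite to its vertex of color $c$, respecting the colors of the vertices. Such an object is *connected* if the resulting topological space is connected. **Statement.** Let $a_m$ be the number of objects made of $m$ labeled polygons or tetrahedra in one of these models, let $A(z)=\sum_{m\ge0}a_m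 z^m/m!$, and define $d_m$ by $\sum_{m\ge 0} d_m z^m/m! = 1-1/A(z)$. Then: - for triangulated surfaces, $A(z)=\sum_{n\ge 0}(6n-1)!!\,\frac{z^{2n}}{(2n)!}$; - for quadrangulated surfaces, $A(z)=\sum_{n\ge 0}(4n-1)!!\,\frac{z^{n}}{n!}$; - for quadratic square-tiled surfaces, $A(z)=\sum_{n\ge 0}\big((2n-1)!!\big)^2\frac{z^{n}}{n!}$; - for GEMs of dimension $3$, $A(z)=\sum_{n\ge 0}\big((2n-1)!!\big)^4\frac{z^{2n}}{(2n)!}$. Let $p=2$ for triangulated surfaces and for GEMs of dimension $3$, and $p=1$ for quadrangulated surfaces and for quadratic square-tiled surfaces. In each model, the probability $P_n$ that a random object made of $pn$ polygons or tetrahedra is connected satisfies $$P_n\approx 1-\sum_{k\ge 1} d_{pk}\binom{pn}{pk}\frac{a_{p(n-k)}}{a_{pn}}.$$ Moreover $P_n$ has a full asymptotic expansion in powers of $1/n$, that is, there are real numbers $(e_k)$ such that $P_n\approx\sum_{k\ge 0}e_k n^{-k}$ (where, for GEMs, the zero term of index $k=1$ is omitted), and this expansion begins as follows: - a random triangulated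 surface made of $2n$ triangles is connected with probability $$P_n\approx 1-\frac{5}{36n}-\frac{695}{2592n^2}-\frac{216305}{279936n^3}-\cdots;$$ - a random quadrangulated surface made of $n$ quadrilaterals is connected with probability $$P_n\approx 1-\frac{3}{16n}-\frac{183}{512n^2}-\frac{8313}{8192n^3}-\cdots;$$ - a random quadratic square-tiled surface made of $n$ squares is connected with probability $$P_n\approx 1-\frac{1}{4n}-\frac{15}{32n^2}-\frac{167}{128n^3}-\frac{11845}{2048n^4}-\cdots;$$ - a random GEM of dimension $3$ made of $2n$ tetrahedra is connected with probability $$P_n\approx 1-\frac{1}{8n^2}-\frac{3}{16n^3}-\frac{49}{128n^4}-\frac{145}{128n^5}-\cdots.$$ -/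

import Mathlib

open Filter Asymptotics
open scoped Nat PowerSeries

noncomputable section

/-! ### Asymptotic expansions -/

/-- `a n ≈ ∑_{k ≥ 0} f k n`: for every `r`, `a n = ∑_{k=0}^{r} f k n + O(f (r+1) n)`, and
`f (k+1) = o(f k)` for every `k`, as `n → ∞`. -/
def HasAsympExpansion (a : ℕ → ℝ) (f : ℕ → ℕ → ℝ) : Prop :=
  (∀ r : ℕ, (fun n => a n - ∑ k ∈ Finset.range (r + 1), f k n) =O[atTop] f (r + 1)) ∧
    ∀ k : ℕ, f (k + 1) =o[atTop] f k

/-! ### Labeled classes: `X n` is the (finite) type of objects of size `n` -/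

/-- Probability that a uniformly random element of the finite type `X` satisfies `Q`. -/
def uniformProb (X : Type) (Q : X → Prop) : ℝ :=
  (Nat.card {x : X // Q x} : ℝ) / (Nat.card X : ℝ)

/-- The exponential generating function `A(z) = ∑ a_n z^n / n!` of a labeled class. -/
def countingSeries (X : ℕ → Type) : ℝ⟦X⟧ :=
  PowerSeries.mk fun n => (Nat.card (X n) : ℝ) / (n ! : ℝ)

/-- The sequence `d_k` defined by `∑ d_k z^k / k! = 1 - 1 / A(z)`. -/
def derivativeSeq (X : ℕ → Type) (k : ℕ) : ℝ :=
  (k ! : ℝ) * PowerSeries.coeff k (1 - (countingSeries X)⁻¹)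

/-- The terms of `1 - ∑_{k ≥ 1} d_{pk} * binom(pn, pk) * a_{p(n-k)} / a_{pn}`; the term of index
`k` vanishes when `k > n`, because of the binomial coefficient. -/
def derivativeTerm (X : ℕ → Type) (p k n : ℕ) : ℝ :=
  if k = 0 then 1
  else -(derivativeSeq X (p * k) * ((p * n).choose (p * k) : ℝ) *
    ((Nat.card (X (p * (n - k))) : ℝ) / (Nat.card (X (p * n)) : ℝ)))

/-! ### Perfect matchings -/

/-- A perfect matching: a permutation all of whose orbits have length `2`. -/
def IsPerfectMatching {S : Type} (α : Equiv.Perm S) : Prop :=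
  ∀ s, α s ≠ s ∧ α (α s) = s

/-! ### Surfaces obtained by gluing polygons -/

/-- The vertices, in counterclockwise order, of the regular `p`-gon (`k` matters modulo `p`). For
`p = 4` the polygon is a square with horizontal and vertical sides. -/
def polygonVertex (p k : ℕ) : ℂ :=
  Complex.exp (((2 * k + 1 : ℝ) * Real.pi / p : ℝ) * Complex.I)

/-- The solid regular `p`-gon. -/
def polygon (p : ℕ) : Set ℂ := convexHull ℝ (Set.range (polygonVertex p))

/-- The point at parameter `t ∈ [0,1]` of the `s`-th side of the regular `p`-gon, the boundary
being oriented counterclockwise. For `p = 4`, sides `0` and `2` are horizontal, sides `1` and `3`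
are vertical. -/
def sidePoint (p : ℕ) (s : Fin p) (t : ℝ) : ℂ :=
  AffineMap.lineMap (polygonVertex p s) (polygonVertex p (s + 1)) t

/-- Ways of gluing `n` labeled oriented `p`-gons along their sides: perfect matchings of the set
of the `p * n` sides, the element `(i, s)` being the `s`-th side of the `i`-th polygon. -/
def PolygonGluing (p n : ℕ) : Type :=
  {α : Equiv.Perm (Fin n × Fin p) // IsPerfectMatching α}

/-- Each side is identified with its partner by the orientation-reversing isometry. -/
def sideIdentification {p n : ℕ} (α : Equiv.Perm (Fin n × Fin p)) (x y : Fin n × polygon p) :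
    Prop :=
  ∃ s : Fin n × Fin p, ∃ t ∈ Set.Icc (0 : ℝ) 1,
    x.1 = s.1 ∧ (x.2 : ℂ) = sidePoint p s.2 t ∧
      y.1 = (α s).1 ∧ (y.2 : ℂ) = sidePoint p (α s).2 (1 - t)

/-- The surface obtained from `n` polygons, as a topological space (with the quotient topology). -/
abbrev GluedSurface {p n : ℕ} (α : Equiv.Perm (Fin n × Fin p)) : Type :=
  Quot (sideIdentification α)

/-- Triangulated surfaces made of `n` labeled triangles. -/
abbrev TriangulatedSurface (n : ℕ) : Type := PolygonGluing 3 n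

/-- Quadrangulated surfaces made of `n` labeled quadrilaterals. -/
abbrev QuadrangulatedSurface (n : ℕ) : Type := PolygonGluing 4 n

/-- Quadratic square-tiled surfaces made of `n` labeled squares: horizontal sides (`0` and `2`) are
glued to horizontal sides, and vertical sides (`1` and `3`) to vertical sides. -/
def QuadraticSquareTiledSurface (n : ℕ) : Type :=
  {α : PolygonGluing 4 n // ∀ s, ((α.1 s).2 : ℕ) % 2 = (s.2 : ℕ) % 2}

/-! ### Graph encoded manifolds -/

/-- GEMs of dimension `D` made of `n` labeled simplices: one perfect matching of the set of
simplices for each of the `D + 1` colors. -/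
def GEM (D n : ℕ) : Type :=
  Fin (D + 1) → {α : Equiv.Perm (Fin n) // IsPerfectMatching α}

/-- The facet opposite to the vertex of color `c` of the `i`-th simplex is glued to the facet
opposite to the vertex of color `c` of the simplex `α_c(i)`, respecting the colors of vertices. -/
def facetIdentification {D n : ℕ} (g : GEM D n) (x y : Fin n × stdSimplex ℝ (Fin (D + 1))) :
    Prop :=
  ∃ c : Fin (D + 1), (x.2 : Fin (D + 1) → ℝ) c = 0 ∧ y.1 = (g c).1 x.1 ∧ y.2 = x.2

/-- The topological space obtained by gluing the simplices of a GEM. -/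
abbrev GEM.Realization {D n : ℕ} (g : GEM D n) : Type := Quot (facetIdentification g)

/-! ### Probabilities of connectedness -/

/-- Probability that a random triangulated surface made of `m` triangles is connected. -/
def triangulatedConnectedProb (m : ℕ) : ℝ :=
  uniformProb (TriangulatedSurface m) fun α => ConnectedSpace (GluedSurface α.1)

/-- Probability that a random quadrangulated surface made of `m` quadrilaterals is connected. -/
def quadrangulatedConnectedProb (m : ℕ) : ℝ :=
  uniformProb (QuadrangulatedSurface m) fun α => ConnectedSpace (GluedSurface α.1)

/-- Probability that a random quadratic square-tiled surface made of `m` squares is connected. -/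
def squareTiledConnectedProb (m : ℕ) : ℝ :=
  uniformProb (QuadraticSquareTiledSurface m) fun α => ConnectedSpace (GluedSurface α.1.1)

/-- Probability that a random GEM of dimension `D` made of `m` simplices is connected. -/
def gemConnectedProb (D m : ℕ) : ℝ :=
  uniformProb (GEM D m) fun g => ConnectedSpace g.Realization

end

/-! Topology enters only through one remark: a space glued from connected cells is connected exactly
when the gluing moves act transitively on the labels (`connectedSpace_quot_iff`). Each model thus
becomes a class of perfect matchings of labeled copies of a finite set of sides, possibly preserving
a coloring. Marking a label and cutting out its component gives `mul_matchingCount`, which for the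
exponential generating series reads `θA = θC · A` with `θ = z d/dz`; in other words, the connected
objects are counted by `C = log A`.

The coefficients of `A` grow so fast that Bender's method applies: with `B = 1/A`, the coefficient
`C_n` equals `∑_{k<r} B_k A_{n-k}` up to `O(A_{n-r})` (`RapidGrowth.log_isBigO`). Dividing by `A_n`
gives the expansion in terms of `d_k = -k! B_k`. Applying `θ` turns the logarithm into a product and
brings a factor `n` that cancels at the end, while log-convexity makes the middle of every
convolution negligible. Errors are to be compared with the next term, so no term may vanish:
Kaluza's theorem (`RapidGrowth.coeff_inverse_neg`) gives `B_k < 0` for `k ≥ 1`.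

In the variable `z ^ p`, consecutive coefficients of `A` have an explicit rational ratio
(`HasRationalRatio`), hence `A_{n-k}/A_n` has an expansion in powers of `1/n` starting at order
`(s+1)k`. All its coefficients are nonnegative, so summing against the negative `B_k` produces no
cancellation: the coefficients of the resulting expansion are negative from order `s + 1` on, and
zero strictly between orders `0` and `s + 1`. The stated numerical values then follow from the first
few coefficients of `A`. -/

/-! ### Log-convex sequences of rapid growth -/

/-- A positive, strictly log-convex sequence whose consecutive ratios grow at least linearly. -/
structure RapidGrowth (b : ℕ → ℝ) : Prop where
  zero_eq_one : b 0 = 1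
  pos : ∀ n, 0 < b n
  logConvex : ∀ n, b (n + 1) * b (n + 1) < b n * b (n + 2)
  linear : ∃ K : ℝ, ∀ n : ℕ, ((n : ℝ) + 1) * b n ≤ K * b (n + 1)

namespace RapidGrowth

variable {b : ℕ → ℝ} (h : RapidGrowth b)
include h

lemma ratio_strictMono : StrictMono fun n => b (n + 1) / b n := by
  refine strictMono_nat_of_lt_succ fun n => ?_
  rw [div_lt_div_iff₀ (h.pos _) (h.pos _)]
  linarith [h.logConvex n]

lemma mul_succ_le {i j : ℕ} (hij : i ≤ j) : b (i + 1) * b j ≤ b i * b (j + 1) := by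
  have := h.ratio_strictMono.monotone hij
  rw [div_le_div_iff₀ (h.pos _) (h.pos _)] at this
  linarith

/-- Moving one unit from the smaller index to the larger keeps the sum and does not decrease the
product. Each move widens the gap by two, so the induction on `k` must leave the gap `d` free. -/
lemma mul_le_aux (s k : ℕ) (d : ℕ) : b (s + k) * b (s + k + d) ≤ b s * b (s + 2 * k + d) := by
  induction k generalizing d with
  | zero => simp
  | succ k ih =>
    calc b (s + (k + 1)) * b (s + (k + 1) + d)
        = b (s + k + 1) * b (s + k + 1 + d) := by ring_nf
      _ ≤ b (s + k) * b (s + k + 1 + d + 1) := h.mul_succ_le (by omega)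
      _ = b (s + k) * b (s + k + (d + 2)) := by ring_nf
      _ ≤ b s * b (s + 2 * k + (d + 2)) := ih _
      _ = _ := by ring_nf

lemma mul_le (s i j : ℕ) : b (s + i) * b (s + j) ≤ b s * b (s + i + j) := by
  rcases le_total i j with hij | hij
  · obtain ⟨d, rfl⟩ := Nat.exists_eq_add_of_le hij
    have := h.mul_le_aux s i d
    convert this using 3 <;> ring
  · obtain ⟨d, rfl⟩ := Nat.exists_eq_add_of_le hij
    have := h.mul_le_aux s j d
    rw [mul_comm (b _)]
    convert this using 3 <;> ring

lemma exists_linear : ∃ K : ℝ, 0 < K ∧ ∀ n : ℕ, ((n : ℝ) + 1) * b n ≤ K * b (n + 1) := by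
  obtain ⟨K, hK⟩ := h.linear
  refine ⟨K, ?_, hK⟩
  have h0 := hK 0
  have := h.pos 0
  have h1 := h.pos 1
  simp only [Nat.cast_zero, zero_add, one_mul] at h0
  by_contra! hneg
  nlinarith

lemma exists_shift_le (i : ℕ) : ∃ K : ℝ, 0 < K ∧ ∀ n, b n ≤ K * b (n + i) := by
  obtain ⟨K, hK, hlin⟩ := h.exists_linear
  refine ⟨K ^ i, by positivity, fun n => ?_⟩
  induction i with
  | zero => simp
  | succ i ih =>
    refine ih.trans ?_
    rw [pow_succ, mul_assoc]
    refine mul_le_mul_of_nonneg_left ?_ (by positivity)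
    refine le_trans ?_ (hlin (n + i))
    have := h.pos (n + i)
    push_cast
    nlinarith [(Nat.cast_nonneg (n + i) : (0 : ℝ) ≤ ((n + i : ℕ) : ℝ)),
      (Nat.cast_add n i : ((n + i : ℕ) : ℝ) = n + i)]

/-- Convolution sums with both ends removed are negligible. -/
lemma exists_sum_antidiagonal_le (r : ℕ) : ∃ K : ℝ, ∀ m : ℕ,
    ∑ ij ∈ Finset.HasAntidiagonal.antidiagonal m, b (r + ij.1) * b (r + ij.2) ≤ K * b (r + m) := by
  obtain ⟨K, hK, hlin⟩ := h.exists_linear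
  refine ⟨2 * b r + b (r + 1) * K, fun m => ?_⟩
  have hr := h.pos r
  have hr1 := h.pos (r + 1)
  have hm := h.pos (r + m)
  rcases m with _ | _ | m
  · simp only [Finset.Nat.antidiagonal_zero, Finset.sum_singleton, add_zero]
    nlinarith [mul_pos hr1 hK]
  · simp [Finset.Nat.sum_antidiagonal_succ]
    nlinarith [mul_pos hr1 hK]
  · rw [Finset.Nat.sum_antidiagonal_succ, Finset.Nat.sum_antidiagonal_succ']
    -- By log-convexity each of the `m + 1` interior terms is at most the outermost interior one;
    -- linear growth of the ratios then absorbs their number.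
    have key : ∑ ij ∈ Finset.HasAntidiagonal.antidiagonal m, b (r + (ij.1 + 1)) * b (r + (ij.2 + 1)) ≤
        (m + 1) * (b (r + 1) * b (r + 1 + m)) := by
      calc _ ≤ ∑ _ij ∈ Finset.HasAntidiagonal.antidiagonal m, b (r + 1) * b (r + 1 + m) := by
            refine Finset.sum_le_sum fun ij hij => ?_
            rw [Finset.HasAntidiagonal.mem_antidiagonal] at hij
            have := h.mul_le (r + 1) ij.1 ij.2
            rw [add_assoc (r + 1), hij, add_assoc, add_assoc r 1 ij.2, add_comm 1, add_comm 1] at this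
            exact this
        _ = _ := by simp [Finset.Nat.card_antidiagonal]
    have h2 : ((m : ℝ) + 1) * b (r + 1 + m) ≤ K * b (r + (m + 1 + 1)) := by
      have := hlin (r + 1 + m)
      rw [show r + (m + 1 + 1) = r + 1 + m + 1 by ring]
      refine le_trans (mul_le_mul_of_nonneg_right ?_ (h.pos _).le) this
      push_cast
      linarith [(Nat.cast_nonneg r : (0 : ℝ) ≤ r)]
    have h3 := mul_le_mul_of_nonneg_left h2 hr1.le
    simp only [add_zero] at key ⊢
    linarith

end RapidGrowth

/-! ### The Euler operator, Bender's method and Kaluza's theorem -/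

/-- The Euler operator `z d/dz` on power series. -/
noncomputable def eulerOp (F : ℝ⟦X⟧) : ℝ⟦X⟧ := PowerSeries.X * PowerSeries.derivative ℝ F

lemma coeff_eulerOp (F : ℝ⟦X⟧) (n : ℕ) :
    PowerSeries.coeff n (eulerOp F) = n * PowerSeries.coeff n F := by
  rcases n with _ | n
  · simp [eulerOp]
  · rw [eulerOp, PowerSeries.coeff_succ_X_mul, PowerSeries.coeff_derivative]
    push_cast; ring

lemma eulerOp_mul (F G : ℝ⟦X⟧) : eulerOp (F * G) = eulerOp F * G + F * eulerOp G := by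
  simp only [eulerOp, Derivation.leibniz, smul_eq_mul]; ring

lemma eulerOp_sub (F G : ℝ⟦X⟧) : eulerOp (F - G) = eulerOp F - eulerOp G := by
  simp only [eulerOp, map_sub]; ring

lemma eulerOp_coe (P : Polynomial ℝ) :
    eulerOp P = ((Polynomial.X * Polynomial.derivative P : Polynomial ℝ) : ℝ⟦X⟧) := by
  rw [eulerOp, PowerSeries.derivative_coe]; simp

lemma exists_eq_trunc_add_X_pow_mul (r : ℕ) (F : ℝ⟦X⟧) :
    ∃ G : ℝ⟦X⟧, F = (PowerSeries.trunc r F : ℝ⟦X⟧) + PowerSeries.X ^ r * G := by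
  have : (PowerSeries.X : ℝ⟦X⟧) ^ r ∣ F - (PowerSeries.trunc r F : ℝ⟦X⟧) := by
    rw [PowerSeries.X_pow_dvd_iff]
    intro m hm
    simp [Polynomial.coeff_coe, PowerSeries.coeff_trunc, hm]
  obtain ⟨G, hG⟩ := this
  exact ⟨G, by rw [← hG]; ring⟩

/-- A monomial factor only lowers the index, which costs a constant by `exists_shift_le`;
polynomials follow by linearity. -/
lemma RapidGrowth.exists_coeff_polynomial_mul_le {A : ℝ⟦X⟧}
    (h : RapidGrowth fun n => PowerSeries.coeff n A) (Q : Polynomial ℝ) :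
    ∃ K : ℝ, 0 ≤ K ∧ ∀ n, |PowerSeries.coeff n ((Q : ℝ⟦X⟧) * A)| ≤ K * PowerSeries.coeff n A := by
  induction Q using Polynomial.induction_on' with
  | add P Q hP hQ =>
    obtain ⟨K, hK, h1⟩ := hP
    obtain ⟨L, hL, h2⟩ := hQ
    refine ⟨K + L, by positivity, fun n => ?_⟩
    rw [Polynomial.coe_add, add_mul, map_add, add_mul]
    exact (abs_add_le _ _).trans (add_le_add (h1 n) (h2 n))
  | monomial i a =>
    obtain ⟨K, hK, hs⟩ := h.exists_shift_le i
    refine ⟨|a| * K, by positivity, fun n => ?_⟩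
    rw [Polynomial.coe_monomial, PowerSeries.monomial_eq_C_mul_X_pow, mul_assoc,
      PowerSeries.coeff_C_mul, PowerSeries.coeff_X_pow_mul', abs_mul, mul_assoc]
    refine mul_le_mul_of_nonneg_left ?_ (abs_nonneg a)
    split_ifs with hi
    · have := hs (n - i)
      rw [Nat.sub_add_cancel hi] at this
      rwa [abs_of_pos (h.pos (n - i))]
    · have := h.pos n
      simp only [abs_zero]
      positivity

/-- Bender's theorem for the logarithm `C` of a rapidly growing series `A` with inverse `B`: the
coefficients of `C` are asymptotically those of `A` convolved with truncations of `B`. -/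
theorem RapidGrowth.log_isBigO {A B C : ℝ⟦X⟧} (h : RapidGrowth fun n => PowerSeries.coeff n A)
    (hAB : A * B = 1) (hC : eulerOp A = eulerOp C * A)
    (hCle : ∀ n, |PowerSeries.coeff n C| ≤ PowerSeries.coeff n A) (r : ℕ) :
    (fun n => PowerSeries.coeff n C -
      ∑ k ∈ Finset.range r, PowerSeries.coeff k B * PowerSeries.coeff (n - k) A) =O[atTop]
      fun n => PowerSeries.coeff (n - r) A := by
  set T := PowerSeries.trunc r B with hT
  set S := PowerSeries.trunc r (eulerOp C) with hS
  obtain ⟨H, hH⟩ := exists_eq_trunc_add_X_pow_mul r (eulerOp C)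
  obtain ⟨U, hU⟩ := exists_eq_trunc_add_X_pow_mul r B
  rw [← hS] at hH
  rw [← hT] at hU
  have hB : eulerOp B = -(eulerOp C * B) := by
    have h1 : eulerOp A * B + A * eulerOp B = 0 := by
      rw [← eulerOp_mul, hAB]
      simp [eulerOp]
    rw [hC] at h1
    linear_combination B * h1 - (eulerOp C * B + eulerOp B) * hAB
  have hV : 1 - (T : ℝ⟦X⟧) * A = PowerSeries.X ^ r * (U * A) := by
    rw [← hAB, hU]; ring
  -- Truncation does not change coefficients below `r`, and there `θC · B + θB = 0`. The quotient
  -- `Q` is a polynomial, so that multiplying `A` by it is harmless.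
  obtain ⟨Q, hQ⟩ : (Polynomial.X : Polynomial ℝ) ^ r ∣
      S * T + Polynomial.X * Polynomial.derivative T := by
    rw [Polynomial.X_pow_dvd_iff]
    intro d hd
    have e1 : PowerSeries.coeff d ((S : ℝ⟦X⟧) * (T : ℝ⟦X⟧)) =
        PowerSeries.coeff d (eulerOp C * B) :=
      (PowerSeries.coeff_mul_eq_coeff_trunc_mul_trunc _ _ hd).symm
    rw [← Polynomial.coeff_coe, Polynomial.coe_add, Polynomial.coe_mul, ← eulerOp_coe, map_add,
      coeff_eulerOp, e1, Polynomial.coeff_coe, hT, PowerSeries.coeff_trunc, if_pos hd,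
      ← coeff_eulerOp, hB]
    simp
  have hQ' : (S : ℝ⟦X⟧) * (T : ℝ⟦X⟧) + eulerOp T = PowerSeries.X ^ r * (Q : ℝ⟦X⟧) := by
    rw [eulerOp_coe, ← Polynomial.coe_mul, ← Polynomial.coe_add, hQ]; simp
  -- The factor `X ^ r` comes once from `1 - T A` and once from the tail of `θC`. What remains is a
  -- polynomial, a polynomial multiple of `A` shifted by `r`, and a convolution with both ends
  -- removed.
  have key : eulerOp (C - (T : ℝ⟦X⟧) * A) =
      (S : ℝ⟦X⟧) - PowerSeries.X ^ r * ((Q : ℝ⟦X⟧) * A) + PowerSeries.X ^ (2 * r) * (H * (U * A)) := by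
    have e1 : eulerOp (C - (T : ℝ⟦X⟧) * A) = eulerOp C * (1 - (T : ℝ⟦X⟧) * A) - eulerOp T * A := by
      rw [eulerOp_sub, eulerOp_mul, hC]; ring
    rw [e1]
    linear_combination (1 - (T : ℝ⟦X⟧) * A) * hH - A * hQ' + (PowerSeries.X ^ r * H) * hV
  obtain ⟨K₁, hK₁, hQb⟩ := h.exists_coeff_polynomial_mul_le Q
  obtain ⟨K₃, hK₃, hTb'⟩ := h.exists_coeff_polynomial_mul_le T
  obtain ⟨K₄, hmid⟩ := h.exists_sum_antidiagonal_le r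
  have hHb : ∀ k, |PowerSeries.coeff k H| ≤ ((r + k : ℕ) : ℝ) * PowerSeries.coeff (r + k) A := by
    intro k
    have h1 : PowerSeries.coeff (r + k) (eulerOp C) = PowerSeries.coeff k H := by
      conv_lhs => rw [hH]
      rw [map_add, Polynomial.coeff_coe, PowerSeries.coeff_trunc, if_neg (by omega), add_comm r k,
        PowerSeries.coeff_X_pow_mul, zero_add]
    rw [← h1, coeff_eulerOp, abs_mul, abs_of_nonneg (Nat.cast_nonneg _)]
    exact mul_le_mul_of_nonneg_left (hCle _) (Nat.cast_nonneg _)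
  have hUb : ∀ k, |PowerSeries.coeff k (U * A)| ≤ (1 + K₃) * PowerSeries.coeff (r + k) A := by
    intro k
    have h1 : PowerSeries.coeff (r + k) (1 - (T : ℝ⟦X⟧) * A) = PowerSeries.coeff k (U * A) := by
      rw [hV, add_comm r k, PowerSeries.coeff_X_pow_mul]
    rw [← h1, map_sub, add_mul]
    refine (abs_sub _ _).trans (add_le_add ?_ (hTb' _))
    have hp := h.pos (r + k)
    have h0 := h.zero_eq_one
    rw [PowerSeries.coeff_one]
    split_ifs with h2
    · rw [h2, h0]; simp
    · simpa using hp.le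
  refine IsBigO.of_bound (K₁ + (1 + K₃) * K₄) ?_
  -- Beyond this index `S` no longer contributes, `n - 2 * r` is a genuine subtraction, and `n` is
  -- positive and can be cancelled.
  filter_upwards [eventually_ge_atTop (2 * r + 1)] with n hn
  have hn0 : (0 : ℝ) < n := by exact_mod_cast (by omega : 0 < n)
  have hpos := h.pos (n - r)
  have hcoef : PowerSeries.coeff n ((T : ℝ⟦X⟧) * A) =
      ∑ k ∈ Finset.range r, PowerSeries.coeff k B * PowerSeries.coeff (n - k) A := by
    rw [PowerSeries.coeff_mul, Finset.Nat.sum_antidiagonal_eq_sum_range_succ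
      (fun i j => PowerSeries.coeff i (T : ℝ⟦X⟧) * PowerSeries.coeff j A)]
    symm
    refine Finset.sum_subset_zero_on_sdiff (Finset.range_mono (by omega)) ?_ ?_
    · intro x hx
      simp only [Finset.mem_sdiff, Finset.mem_range, not_lt] at hx
      rw [Polynomial.coeff_coe, hT, PowerSeries.coeff_trunc, if_neg (by omega), zero_mul]
    · intro x hx
      rw [Finset.mem_range] at hx
      rw [Polynomial.coeff_coe, hT, PowerSeries.coeff_trunc, if_pos hx]
  rw [← hcoef, ← map_sub, Real.norm_eq_abs, Real.norm_eq_abs, abs_of_pos hpos]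
  have hmain : (n : ℝ) * |PowerSeries.coeff n (C - (T : ℝ⟦X⟧) * A)| ≤
      n * ((K₁ + (1 + K₃) * K₄) * PowerSeries.coeff (n - r) A) := by
    have e := congrArg (PowerSeries.coeff n) key
    rw [coeff_eulerOp, map_add, map_sub _ (S : ℝ⟦X⟧), Polynomial.coeff_coe, hS, PowerSeries.coeff_trunc,
      if_neg (by omega), PowerSeries.coeff_X_pow_mul', if_pos (by omega),
      PowerSeries.coeff_X_pow_mul', if_pos (by omega), zero_sub] at e
    have habs : (n : ℝ) * |PowerSeries.coeff n (C - (T : ℝ⟦X⟧) * A)| =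
        |(n : ℝ) * PowerSeries.coeff n (C - (T : ℝ⟦X⟧) * A)| := by
      rw [abs_mul, abs_of_pos hn0]
    rw [habs, e]
    have b1 := hQb (n - r)
    have hn1 : (1 : ℝ) ≤ n := by exact_mod_cast (by omega : 1 ≤ n)
    -- The Euler operator costs a factor at most `n` in the coefficients of `H`; it is the only
    -- loss, and the left side carries the same factor.
    have b2 : |PowerSeries.coeff (n - 2 * r) (H * (U * A))| ≤
        n * ((1 + K₃) * (K₄ * PowerSeries.coeff (n - r) A)) := by
      rw [PowerSeries.coeff_mul]
      have hm := hmid (n - 2 * r)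
      rw [show r + (n - 2 * r) = n - r by omega] at hm
      refine (Finset.abs_sum_le_sum_abs _ _).trans ?_
      refine le_trans ?_ (mul_le_mul_of_nonneg_left
        (mul_le_mul_of_nonneg_left hm (by positivity : 0 ≤ 1 + K₃)) hn0.le)
      rw [Finset.mul_sum, Finset.mul_sum]
      refine Finset.sum_le_sum fun ij hij => ?_
      rw [Finset.HasAntidiagonal.mem_antidiagonal] at hij
      rw [abs_mul]
      have hp1 := (h.pos (r + ij.1)).le
      have hp2 := (h.pos (r + ij.2)).le
      have hle : ((r + ij.1 : ℕ) : ℝ) ≤ n := by exact_mod_cast (by omega : r + ij.1 ≤ n)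
      calc _ ≤ (((r + ij.1 : ℕ) : ℝ) * PowerSeries.coeff (r + ij.1) A) *
            ((1 + K₃) * PowerSeries.coeff (r + ij.2) A) :=
            mul_le_mul (hHb _) (hUb _) (abs_nonneg _) (by positivity)
        _ ≤ ((n : ℝ) * PowerSeries.coeff (r + ij.1) A) *
            ((1 + K₃) * PowerSeries.coeff (r + ij.2) A) := by gcongr
        _ = _ := by ring
    calc _ ≤ |(-PowerSeries.coeff (n - r) ((Q : ℝ⟦X⟧) * A))| +
          |PowerSeries.coeff (n - 2 * r) (H * (U * A))| := abs_add_le _ _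
      _ ≤ n * (K₁ * PowerSeries.coeff (n - r) A) +
          n * ((1 + K₃) * (K₄ * PowerSeries.coeff (n - r) A)) := by
          rw [abs_neg]
          refine add_le_add (b1.trans ?_) b2
          exact le_mul_of_one_le_left (by positivity) hn1
      _ = _ := by ring
  exact le_of_mul_le_mul_left hmain hn0

/-- Kaluza's theorem: the inverse of a strictly log-convex series has negative coefficients. -/
theorem RapidGrowth.coeff_inverse_neg {A B : ℝ⟦X⟧}
    (h : RapidGrowth fun n => PowerSeries.coeff n A) (hAB : A * B = 1) (n : ℕ) :
    PowerSeries.coeff (n + 1) B < 0 := by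
  have h0 := h.zero_eq_one
  have hrec : ∀ m, PowerSeries.coeff (m + 1) A + ∑ ij ∈ Finset.HasAntidiagonal.antidiagonal m,
      PowerSeries.coeff (ij.1 + 1) B * PowerSeries.coeff ij.2 A = 0 := by
    intro m
    have hB0 : PowerSeries.coeff 0 B = 1 := by
      have := congrArg (PowerSeries.coeff 0) hAB
      simpa [PowerSeries.coeff_mul, h0] using this
    have := congrArg (PowerSeries.coeff (m + 1)) hAB
    rw [mul_comm, PowerSeries.coeff_mul, Finset.Nat.sum_antidiagonal_succ, hB0] at this
    simpa [PowerSeries.coeff_one] using this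
  induction n using Nat.strong_induction_on with
  | _ n ih =>
    rcases n with _ | n
    · have := hrec 0
      have hp := h.pos 1
      simp [h0] at this
      simp only [zero_add]
      linarith
    · have h1 := hrec n
      have h2 := hrec (n + 1)
      rw [Finset.Nat.sum_antidiagonal_succ'] at h2
      simp only [h0, mul_one] at h2
      -- Subtracting `ρ` times one convolution identity from the next eliminates the isolated
      -- coefficients of `A`. Since ratios increase strictly, `ρ` exceeds every ratio that occurs in
      -- the remaining sum.
      set ρ := PowerSeries.coeff (n + 1 + 1) A / PowerSeries.coeff (n + 1) A with hρ
      have hp := h.pos (n + 1)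
      have h3 : PowerSeries.coeff (n + 1 + 1) A = ρ * PowerSeries.coeff (n + 1) A := by
        rw [hρ, div_mul_cancel₀ _ hp.ne']
      have h4 : PowerSeries.coeff (n + 1 + 1) B = ∑ ij ∈ Finset.HasAntidiagonal.antidiagonal n,
          PowerSeries.coeff (ij.1 + 1) B *
            (ρ * PowerSeries.coeff ij.2 A - PowerSeries.coeff (ij.2 + 1) A) := by
        simp only [mul_sub, Finset.sum_sub_distrib]
        have : ∑ ij ∈ Finset.HasAntidiagonal.antidiagonal n,
            PowerSeries.coeff (ij.1 + 1) B * (ρ * PowerSeries.coeff ij.2 A) =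
            ρ * ∑ ij ∈ Finset.HasAntidiagonal.antidiagonal n,
              PowerSeries.coeff (ij.1 + 1) B * PowerSeries.coeff ij.2 A := by
          rw [Finset.mul_sum]
          exact Finset.sum_congr rfl fun _ _ => by ring
        rw [this]
        linear_combination h2 - ρ * h1 - h3
      rw [h4]
      refine Finset.sum_neg (fun ij hij => ?_) ⟨(0, n), by simp⟩
      rw [Finset.HasAntidiagonal.mem_antidiagonal] at hij
      refine mul_neg_of_neg_of_pos (ih _ (by omega)) ?_
      have := h.ratio_strictMono (by omega : ij.2 < n + 1)
      have hp2 := h.pos ij.2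
      simp only at this
      rw [div_lt_iff₀ hp2, ← hρ] at this
      linarith

/-! ### Expansions in powers of `1 / n` -/

/-- `f n` admits the (formal) expansion `F` in powers of `1 / n`. -/
def HasInvExpansion (f : ℕ → ℝ) (F : ℝ⟦X⟧) : Prop :=
  ∀ r : ℕ, ∃ P : Polynomial ℝ, PowerSeries.X ^ r ∣ F - (P : ℝ⟦X⟧) ∧
    (fun n => f n - P.eval ((n : ℝ)⁻¹)) =O[atTop] fun n : ℕ => ((n : ℝ)⁻¹) ^ r

lemma tendsto_polynomial_eval_inv (P : Polynomial ℝ) :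
    Tendsto (fun n : ℕ => P.eval ((n : ℝ)⁻¹)) atTop (nhds (P.eval 0)) :=
  (P.continuous.tendsto 0).comp tendsto_inv_atTop_nhds_zero_nat

lemma polynomial_eval_inv_isBigO {P : Polynomial ℝ} {r : ℕ}
    (h : (PowerSeries.X : ℝ⟦X⟧) ^ r ∣ (P : ℝ⟦X⟧)) :
    (fun n : ℕ => P.eval ((n : ℝ)⁻¹)) =O[atTop] fun n : ℕ => ((n : ℝ)⁻¹) ^ r := by
  have : (Polynomial.X : Polynomial ℝ) ^ r ∣ P := by
    rw [Polynomial.X_pow_dvd_iff]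
    intro d hd
    rw [← Polynomial.coeff_coe]
    exact PowerSeries.X_pow_dvd_iff.1 h d hd
  obtain ⟨Q, rfl⟩ := this
  simp only [Polynomial.eval_mul, Polynomial.eval_pow, Polynomial.eval_X]
  simpa using (isBigO_refl (fun n : ℕ => ((n : ℝ)⁻¹) ^ r) atTop).mul
    ((tendsto_polynomial_eval_inv Q).isBigO_one ℝ)

lemma inv_pow_isBigO {r s : ℕ} (h : r ≤ s) :
    (fun n : ℕ => ((n : ℝ)⁻¹) ^ s) =O[atTop] fun n : ℕ => ((n : ℝ)⁻¹) ^ r := by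
  refine IsBigO.of_bound 1 (Eventually.of_forall fun n => ?_)
  rw [one_mul, norm_pow, norm_pow]
  refine pow_le_pow_of_le_one (norm_nonneg _) ?_ h
  rw [norm_inv]
  simpa using Nat.cast_inv_le_one (α := ℝ) n

namespace HasInvExpansion

lemma congr' {f g : ℕ → ℝ} {F : ℝ⟦X⟧} (hf : HasInvExpansion f F) (h : f =ᶠ[atTop] g) :
    HasInvExpansion g F := fun r => by
  obtain ⟨P, h1, h2⟩ := hf r
  refine ⟨P, h1, h2.congr' ?_ EventuallyEq.rfl⟩
  filter_upwards [h] with n hn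
  rw [hn]

lemma polynomial (P : Polynomial ℝ) :
    HasInvExpansion (fun n => P.eval ((n : ℝ)⁻¹)) (P : ℝ⟦X⟧) :=
  fun r => ⟨P, by simp, by simpa using isBigO_zero _ _⟩

lemma const (a : ℝ) : HasInvExpansion (fun _ => a) (PowerSeries.C a) := by
  simpa using polynomial (Polynomial.C a)

lemma add {f g : ℕ → ℝ} {F G : ℝ⟦X⟧} (hf : HasInvExpansion f F) (hg : HasInvExpansion g G) :
    HasInvExpansion (fun n => f n + g n) (F + G) := fun r => by
  obtain ⟨P, hP, hP'⟩ := hf r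
  obtain ⟨Q, hQ, hQ'⟩ := hg r
  refine ⟨P + Q, ?_, (hP'.add hQ').congr_left fun n => ?_⟩
  · rw [Polynomial.coe_add]
    convert dvd_add hP hQ using 1; ring
  · rw [Polynomial.eval_add]; ring

lemma sum {ι : Type*} (s : Finset ι) {f : ι → ℕ → ℝ} {F : ι → ℝ⟦X⟧}
    (h : ∀ i ∈ s, HasInvExpansion (f i) (F i)) :
    HasInvExpansion (fun n => ∑ i ∈ s, f i n) (∑ i ∈ s, F i) := by
  classical
  induction s using Finset.induction_on with
  | empty => simpa using const 0
  | insert a s ha ih =>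
    simp only [Finset.sum_insert ha]
    exact (h a (by simp)).add (ih fun i hi => h i (by simp [hi]))

lemma mul {f g : ℕ → ℝ} {F G : ℝ⟦X⟧} (hf : HasInvExpansion f F) (hg : HasInvExpansion g G) :
    HasInvExpansion (fun n => f n * g n) (F * G) := fun r => by
  obtain ⟨P, hP, hP'⟩ := hf r
  obtain ⟨Q, hQ, hQ'⟩ := hg r
  refine ⟨P * Q, ?_, ?_⟩
  · rw [Polynomial.coe_mul]
    convert dvd_add (hP.mul_right G) (hQ.mul_left (P : ℝ⟦X⟧)) using 1; ring
  · have hb : ∀ R : Polynomial ℝ, (fun n : ℕ => R.eval ((n : ℝ)⁻¹)) =O[atTop] fun _ => (1 : ℝ) :=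
      fun R => (tendsto_polynomial_eval_inv R).isBigO_one ℝ
    have hg1 : g =O[atTop] fun _ => (1 : ℝ) := by
      have h1 : (fun n => g n - Q.eval ((n : ℝ)⁻¹)) =O[atTop] fun _ : ℕ => (1 : ℝ) := by
        simpa using hQ'.trans (inv_pow_isBigO (Nat.zero_le r))
      exact (h1.add (hb Q)).congr_left fun n => by ring
    have h1 := hP'.mul hg1
    have h2 := (hb P).mul hQ'
    simp only [mul_one, one_mul] at h1 h2
    refine (h1.add h2).congr_left fun n => ?_
    rw [Polynomial.eval_mul]; ring

lemma prod_range {f : ℕ → ℕ → ℝ} {F : ℕ → ℝ⟦X⟧} (h : ∀ i, HasInvExpansion (f i) (F i)) (k : ℕ) :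
    HasInvExpansion (fun n => ∏ i ∈ Finset.range k, f i n) (∏ i ∈ Finset.range k, F i) := by
  induction k with
  | zero => simpa using const 1
  | succ k ih =>
    simp only [Finset.prod_range_succ]
    exact ih.mul (h k)

lemma pow {f : ℕ → ℝ} {F : ℝ⟦X⟧} (h : HasInvExpansion f F) (k : ℕ) :
    HasInvExpansion (fun n => f n ^ k) (F ^ k) := by
  simpa using prod_range (fun _ => h) k

lemma geometric (c : ℝ) :
    HasInvExpansion (fun n => (1 - c * (n : ℝ)⁻¹)⁻¹) (PowerSeries.mk fun j => c ^ j) := fun r => by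
  refine ⟨PowerSeries.trunc r (PowerSeries.mk fun j => c ^ j), ?_, ?_⟩
  · rw [PowerSeries.X_pow_dvd_iff]
    intro m hm
    simp [Polynomial.coeff_coe, PowerSeries.coeff_trunc, hm]
  -- The tail of the geometric series is `(c / n) ^ r` times `1 / (1 - c / n)`, and the latter is
  -- bounded.
  · have hlim : Tendsto (fun n : ℕ => 1 - c * (n : ℝ)⁻¹) atTop (nhds 1) := by
      simpa using (tendsto_inv_atTop_nhds_zero_nat (𝕜 := ℝ)).const_mul c |>.const_sub 1
    have hinv := ((hlim.inv₀ one_ne_zero).isBigO_one ℝ).const_mul_left (c ^ r)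
    have := hinv.mul (isBigO_refl (fun n : ℕ => ((n : ℝ)⁻¹) ^ r) atTop)
    simp only [one_mul] at this
    refine this.congr' ?_ EventuallyEq.rfl
    filter_upwards [hlim.eventually_ne one_ne_zero] with n hn
    have hs : (PowerSeries.trunc r (PowerSeries.mk fun j => c ^ j)).eval ((n : ℝ)⁻¹) =
        ∑ j ∈ Finset.range r, (c * (n : ℝ)⁻¹) ^ j := by
      rw [Polynomial.eval, PowerSeries.eval₂_trunc_eq_sum_range]
      simp [mul_pow]
    have hg := mul_neg_geom_sum (c * (n : ℝ)⁻¹) r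
    rw [hs, mul_right_comm, ← mul_pow]
    generalize c * (n : ℝ)⁻¹ = y at hn hg
    rw [eq_sub_iff_add_eq]
    field_simp
    linear_combination hg

/-- The polynomial witnessing order `r` agrees with `F` modulo `X ^ r`, so replacing it by the
truncation of `F` costs only `O(n ^ (-r))`. -/
lemma isBigO_sub {f : ℕ → ℝ} {F : ℝ⟦X⟧} (h : HasInvExpansion f F) (r : ℕ) :
    (fun n => f n - ∑ j ∈ Finset.range r, PowerSeries.coeff j F * ((n : ℝ)⁻¹) ^ j) =O[atTop]
      fun n : ℕ => ((n : ℝ)⁻¹) ^ r := by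
  obtain ⟨P, hP, hP'⟩ := h r
  have h2 : (PowerSeries.X : ℝ⟦X⟧) ^ r ∣ ((P - PowerSeries.trunc r F : Polynomial ℝ) : ℝ⟦X⟧) := by
    rw [PowerSeries.X_pow_dvd_iff] at hP ⊢
    intro m hm
    have := hP m hm
    rw [map_sub, sub_eq_zero, Polynomial.coeff_coe] at this
    rw [Polynomial.coeff_coe, Polynomial.coeff_sub, PowerSeries.coeff_trunc, if_pos hm, this,
      sub_self]
  refine (hP'.add (polynomial_eval_inv_isBigO h2)).congr_left fun n => ?_
  have hs : (PowerSeries.trunc r F).eval ((n : ℝ)⁻¹) =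
      ∑ j ∈ Finset.range r, PowerSeries.coeff j F * ((n : ℝ)⁻¹) ^ j := by
    rw [Polynomial.eval, PowerSeries.eval₂_trunc_eq_sum_range]
    simp
  rw [Polynomial.eval_sub, hs]
  ring

lemma of_approx {f : ℕ → ℝ} {F : ℝ⟦X⟧}
    (h : ∀ r : ℕ, ∃ (g : ℕ → ℝ) (G : ℝ⟦X⟧), HasInvExpansion g G ∧ PowerSeries.X ^ r ∣ F - G ∧
      (fun n => f n - g n) =O[atTop] fun n : ℕ => ((n : ℝ)⁻¹) ^ r) : HasInvExpansion f F :=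
  fun r => by
    obtain ⟨g, G, hg, hFG, hfg⟩ := h r
    obtain ⟨P, hP, hP'⟩ := hg r
    refine ⟨P, ?_, (hfg.add hP').congr_left fun n => by ring⟩
    convert dvd_add hFG hP using 1; ring

end HasInvExpansion

/-! ### Series whose coefficients have rational ratios -/

/-- The coefficients of `A` are `1, …` with consecutive ratio
`(N - α) (N - β) (N - γ) ^ s / (c N)` from index `N - 1` to index `N`. -/
structure HasRationalRatio (A : ℝ⟦X⟧) (c α β γ : ℝ) (s : ℕ) : Prop where
  coeff_zero : PowerSeries.coeff 0 A = 1
  c_pos : 0 < c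
  α_pos : 0 < α
  α_lt : α < 1
  β_pos : 0 < β
  β_lt : β < 1
  γ_pos : 0 < γ
  γ_lt : γ < 1
  ratio : ∀ n : ℕ, PowerSeries.coeff n A *
    (((n : ℝ) + 1 - α) * ((n : ℝ) + 1 - β) * ((n : ℝ) + 1 - γ) ^ s) =
      c * ((n : ℝ) + 1) * PowerSeries.coeff (n + 1) A

/-- The series with coefficients `c ^ j`. -/
noncomputable def geometricSeries (c : ℝ) : ℝ⟦X⟧ := PowerSeries.mk fun j => c ^ j

/-- Normalized expansion in powers of `1 / n` of the ratio of the coefficients of index `n - m - 1`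
and `n - m`. -/
noncomputable def unitRatioSeries (α β γ : ℝ) (s m : ℕ) : ℝ⟦X⟧ :=
  (1 - PowerSeries.C (m : ℝ) * PowerSeries.X) * geometricSeries (m + α) *
    geometricSeries (m + β) * geometricSeries (m + γ) ^ s

/-- Expansion in powers of `1 / n` of the ratio of the coefficients of index `n - m - 1` and
`n - m`. -/
noncomputable def ratioSeries (c α β γ : ℝ) (s m : ℕ) : ℝ⟦X⟧ :=
  PowerSeries.C c * PowerSeries.X ^ (s + 1) * unitRatioSeries α β γ s m

/-- Coefficients of the expansion in powers of `1 / n` of the probability of connectedness. -/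
noncomputable def connectedCoeff (B : ℝ⟦X⟧) (c α β γ : ℝ) (s j : ℕ) : ℝ :=
  ∑ k ∈ Finset.range (j + 1), PowerSeries.coeff k B *
    PowerSeries.coeff j (∏ m ∈ Finset.range k, ratioSeries c α β γ s m)

/-! ### Power series with nonnegative coefficients -/

section Positivity

/-- All coefficients are nonnegative. -/
def NonnegCoeff (F : ℝ⟦X⟧) : Prop := ∀ j, 0 ≤ PowerSeries.coeff j F

lemma NonnegCoeff.mul {F G : ℝ⟦X⟧} (hF : NonnegCoeff F) (hG : NonnegCoeff G) :
    NonnegCoeff (F * G) := fun j => by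
  rw [PowerSeries.coeff_mul]
  exact Finset.sum_nonneg fun ij _ => mul_nonneg (hF _) (hG _)

lemma NonnegCoeff.one : NonnegCoeff 1 := fun j => by
  rw [PowerSeries.coeff_one]; split_ifs <;> norm_num

lemma NonnegCoeff.pow {F : ℝ⟦X⟧} (hF : NonnegCoeff F) (k : ℕ) : NonnegCoeff (F ^ k) := by
  induction k with
  | zero => simpa using NonnegCoeff.one
  | succ k ih => rw [pow_succ]; exact ih.mul hF

lemma NonnegCoeff.prod {ι : Type*} (t : Finset ι) {F : ι → ℝ⟦X⟧} (hF : ∀ i, NonnegCoeff (F i)) :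
    NonnegCoeff (∏ i ∈ t, F i) := by
  classical
  induction t using Finset.induction_on with
  | empty => simpa using NonnegCoeff.one
  | insert a t ha ih => rw [Finset.prod_insert ha]; exact (hF a).mul ih

lemma NonnegCoeff.coeff_mul_pos {F G : ℝ⟦X⟧} (hF : ∀ j, 0 < PowerSeries.coeff j F)
    (hG : NonnegCoeff G) (hG0 : 0 < PowerSeries.coeff 0 G) (j : ℕ) :
    0 < PowerSeries.coeff j (F * G) := by
  rw [PowerSeries.coeff_mul]
  exact Finset.sum_pos' (fun ij _ => mul_nonneg (hF _).le (hG _))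
    ⟨(j, 0), by simp, mul_pos (hF _) hG0⟩

lemma nonnegCoeff_geometricSeries {c : ℝ} (hc : 0 ≤ c) : NonnegCoeff (geometricSeries c) :=
  fun j => by rw [geometricSeries, PowerSeries.coeff_mk]; positivity

/-- Beyond the constant term, the coefficients of `(1 - a X) / (1 - c X)` are `c ^ j * (c - a)`.
This compensates the only negative sign in `unitRatioSeries`. -/
lemma nonnegCoeff_one_sub_mul_geometricSeries {a c : ℝ} (ha : 0 ≤ a) (hac : a ≤ c) :
    NonnegCoeff ((1 - PowerSeries.C a * PowerSeries.X) * geometricSeries c) := fun j => by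
  rw [sub_mul, one_mul, map_sub, mul_assoc, PowerSeries.coeff_C_mul]
  rcases j with _ | j
  · simp [geometricSeries]
  · rw [PowerSeries.coeff_succ_X_mul, geometricSeries, PowerSeries.coeff_mk, PowerSeries.coeff_mk,
      pow_succ]
    have : 0 ≤ c ^ j := pow_nonneg (ha.trans hac) _
    nlinarith

end Positivity

/-! ### Growth and connectedness expansions from the ratio -/

namespace HasRationalRatio

variable {A B C : ℝ⟦X⟧} {c α β γ : ℝ} {s : ℕ} (h : HasRationalRatio A c α β γ s)
include h

lemma rapidGrowth : RapidGrowth fun n => PowerSeries.coeff n A := by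
  obtain ⟨h0, hc, hα, ha, hβ, hb, hγ, hg, hr⟩ := h
  have hfac : ∀ n : ℕ, 0 < ((n : ℝ) + 1 - α) * ((n : ℝ) + 1 - β) * ((n : ℝ) + 1 - γ) ^ s := by
    intro n
    have hn : (0 : ℝ) ≤ n := Nat.cast_nonneg n
    have e1 : (0 : ℝ) < (n : ℝ) + 1 - α := by linarith
    have e2 : (0 : ℝ) < (n : ℝ) + 1 - β := by linarith
    have e3 : (0 : ℝ) < (n : ℝ) + 1 - γ := by linarith
    positivity
  have hpos : ∀ n, 0 < PowerSeries.coeff n A := by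
    intro n
    induction n with
    | zero => rw [h0]; exact one_pos
    | succ n ih =>
      have h1 := mul_pos ih (hfac n)
      rw [hr n] at h1
      exact pos_of_mul_pos_right h1 (by positivity)
  -- With `N = n + 1 ≥ 1`, the bounds `N - α ≥ N (1 - α)` and `N - β ≥ N (1 - β)` give `N ^ 2`, and
  -- `(N - γ) ^ s ≥ (1 - γ) ^ s`; dividing by `c N` leaves linear growth with this constant.
  refine ⟨h0, hpos, fun n => ?_, c / ((1 - α) * (1 - β) * (1 - γ) ^ s), fun n => ?_⟩
  · have r0 := hr n
    have r1 := hr (n + 1)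
    have p0 := hpos n
    have p1 := hpos (n + 1)
    have hn : (0 : ℝ) ≤ n := Nat.cast_nonneg n
    push_cast at r1
    set N : ℝ := (n : ℝ) + 1 with hN
    have hN1 : 1 ≤ N := by linarith
    -- The ratio increases because `(N - α) / N` does, as `α > 0`, and the other factors increase
    -- with `N`.
    have key : (N - α) * (N - β) * (N - γ) ^ s * (N + 1) <
        (N + 1 - α) * (N + 1 - β) * (N + 1 - γ) ^ s * N := by
      have q1 : (N - α) * (N + 1) < (N + 1 - α) * N := by nlinarith
      have q2 : N - β < N + 1 - β := by linarith
      have q3 : (N - γ) ^ s ≤ (N + 1 - γ) ^ s := pow_le_pow_left₀ (by linarith) (by linarith) s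
      have q4 : 0 < (N - γ) ^ s := pow_pos (by linarith) s
      have q5 : 0 < N - α := by linarith
      calc _ = (N - α) * (N + 1) * (N - β) * (N - γ) ^ s := by ring
        _ < (N + 1 - α) * N * (N + 1 - β) * (N + 1 - γ) ^ s := by
          refine mul_lt_mul (mul_lt_mul'' q1 q2 (by positivity) (by linarith)) q3 q4 ?_
          exact mul_nonneg (mul_nonneg (by linarith) (by linarith)) (by linarith)
        _ = _ := by ring
    have hcN : 0 < c * N * (N + 1) := by positivity
    refine lt_of_mul_lt_mul_left ?_ hcN.le
    calc c * N * (N + 1) * (PowerSeries.coeff (n + 1) A * PowerSeries.coeff (n + 1) A)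
        = PowerSeries.coeff n A * PowerSeries.coeff (n + 1) A *
          ((N - α) * (N - β) * (N - γ) ^ s * (N + 1)) := by
          linear_combination -(N + 1) * PowerSeries.coeff (n + 1) A * r0
      _ < PowerSeries.coeff n A * PowerSeries.coeff (n + 1) A *
          ((N + 1 - α) * (N + 1 - β) * (N + 1 - γ) ^ s * N) :=
          mul_lt_mul_of_pos_left key (mul_pos p0 p1)
      _ = _ := by linear_combination N * PowerSeries.coeff n A * r1
  · have r0 := hr n
    have p0 := hpos n
    have hn : (0 : ℝ) ≤ n := Nat.cast_nonneg n
    set N : ℝ := (n : ℝ) + 1 with hN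
    have hN1 : 1 ≤ N := by linarith
    have t1 : 0 < 1 - α := by linarith
    have t2 : 0 < 1 - β := by linarith
    have t3 : 0 < 1 - γ := by linarith
    have key : N * N * ((1 - α) * (1 - β) * (1 - γ) ^ s) ≤
        (N - α) * (N - β) * (N - γ) ^ s := by
      have q1 : N * (1 - α) ≤ N - α := by nlinarith
      have q2 : N * (1 - β) ≤ N - β := by nlinarith
      have q3 : (1 - γ) ^ s ≤ (N - γ) ^ s := pow_le_pow_left₀ t3.le (by linarith) s
      calc _ = N * (1 - α) * (N * (1 - β)) * (1 - γ) ^ s := by ring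
        _ ≤ _ := by gcongr <;> nlinarith
    have hNp : 0 < N := by linarith
    rw [div_mul_eq_mul_div, le_div_iff₀ (by positivity)]
    refine le_of_mul_le_mul_left ?_ hNp
    calc N * (N * PowerSeries.coeff n A * ((1 - α) * (1 - β) * (1 - γ) ^ s))
        = PowerSeries.coeff n A * (N * N * ((1 - α) * (1 - β) * (1 - γ) ^ s)) := by ring
      _ ≤ PowerSeries.coeff n A * ((N - α) * (N - β) * (N - γ) ^ s) :=
          mul_le_mul_of_nonneg_left key p0.le
      _ = _ := by rw [r0]; ring

lemma hasInvExpansion_ratio (m : ℕ) :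
    HasInvExpansion (fun n => PowerSeries.coeff (n - (m + 1)) A / PowerSeries.coeff (n - m) A)
      (ratioSeries c α β γ s m) := by
  have hX : HasInvExpansion (fun n => ((n : ℝ)⁻¹)) PowerSeries.X := by
    simpa using HasInvExpansion.polynomial Polynomial.X
  have hm : HasInvExpansion (fun n => 1 - m * ((n : ℝ)⁻¹))
      (1 - PowerSeries.C (m : ℝ) * PowerSeries.X) := by
    simpa [sub_eq_add_neg] using (HasInvExpansion.const 1).add ((HasInvExpansion.const (-m)).mul hX)
  refine (((HasInvExpansion.const c).mul (hX.pow (s + 1))).mul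
    (((hm.mul (.geometric (m + α))).mul (.geometric (m + β))).mul
      ((HasInvExpansion.geometric (m + γ)).pow s))).congr' ?_
  filter_upwards [eventually_ge_atTop (m + 1)] with n hn
  obtain ⟨d, rfl⟩ := Nat.exists_eq_add_of_le hn
  have hr := h.ratio d
  have hp := h.rapidGrowth.pos (d + 1)
  have ha := h.α_lt
  have hb := h.β_lt
  have hg := h.γ_lt
  rw [show m + 1 + d - (m + 1) = d by omega, show m + 1 + d - m = d + 1 by omega, eq_div_iff hp.ne']
  have hd : (0 : ℝ) ≤ d := Nat.cast_nonneg d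
  have hm0 : (0 : ℝ) ≤ m := Nat.cast_nonneg m
  have hN : (0 : ℝ) < m + 1 + d := by positivity
  -- Here `n = m + 1 + d`, so `n - m - δ = d + 1 - δ`: the factors of the ratio are recovered after
  -- division by `n`.
  have hfac : ∀ δ : ℝ, 1 - ((m : ℝ) + δ) * ((m : ℝ) + 1 + d)⁻¹ =
      ((d : ℝ) + 1 - δ) * ((m : ℝ) + 1 + d)⁻¹ := by
    intro δ; field_simp; ring
  have e0 : 1 - (m : ℝ) * ((m : ℝ) + 1 + d)⁻¹ = ((d : ℝ) + 1) * ((m : ℝ) + 1 + d)⁻¹ := by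
    simpa using hfac 0
  push_cast
  rw [e0, hfac α, hfac β, hfac γ]
  have e1 : (0 : ℝ) < (d : ℝ) + 1 - α := by linarith
  have e2 : (0 : ℝ) < (d : ℝ) + 1 - β := by linarith
  have e3 : (0 : ℝ) < (d : ℝ) + 1 - γ := by linarith
  have e4 : (0 : ℝ) < ((d : ℝ) + 1 - γ) ^ s := by positivity
  rw [← mul_left_inj' (mul_pos (mul_pos e1 e2) e4).ne', hr]
  have e1' := e1.ne'
  have e2' := e2.ne'
  have e3' := e3.ne'
  rw [pow_succ, mul_inv, mul_inv, mul_inv, inv_inv, mul_pow, inv_pow]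
  field_simp
  rw [mul_assoc, ← mul_pow, one_div_mul_cancel e3', one_pow, mul_one]

lemma hasInvExpansion_shift (k : ℕ) :
    HasInvExpansion (fun n => PowerSeries.coeff (n - k) A / PowerSeries.coeff n A)
      (∏ m ∈ Finset.range k, ratioSeries c α β γ s m) := by
  refine (HasInvExpansion.prod_range h.hasInvExpansion_ratio k).congr' (.of_forall fun n => ?_)
  simp only
  have hp := fun n => (h.rapidGrowth.pos n).ne'
  induction k with
  | zero => simp [div_self (hp n)]
  | succ k ih => rw [Finset.prod_range_succ, ih, mul_comm, div_mul_div_cancel₀ (hp _)]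

omit h in
lemma prod_ratioSeries (k : ℕ) : ∏ m ∈ Finset.range k, ratioSeries c α β γ s m =
    PowerSeries.C (c ^ k) * (PowerSeries.X ^ ((s + 1) * k) *
      ∏ m ∈ Finset.range k, unitRatioSeries α β γ s m) := by
  simp only [ratioSeries, Finset.prod_mul_distrib, Finset.prod_const, Finset.card_range, map_pow,
    pow_mul]
  ring

omit h in
lemma coeff_prod_ratioSeries (k j : ℕ) :
    PowerSeries.coeff j (∏ m ∈ Finset.range k, ratioSeries c α β γ s m) =
      if (s + 1) * k ≤ j then c ^ k * PowerSeries.coeff (j - (s + 1) * k)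
        (∏ m ∈ Finset.range k, unitRatioSeries α β γ s m) else 0 := by
  rw [prod_ratioSeries, PowerSeries.coeff_C_mul, PowerSeries.coeff_X_pow_mul']
  split_ifs <;> simp

omit h in
lemma X_pow_dvd_prod_ratioSeries (k : ℕ) :
    PowerSeries.X ^ k ∣ ∏ m ∈ Finset.range k, ratioSeries c α β γ s m := by
  rw [PowerSeries.X_pow_dvd_iff]
  intro j hj
  rw [coeff_prod_ratioSeries, if_neg]
  nlinarith

lemma nonnegCoeff_unitRatioSeries (m : ℕ) : NonnegCoeff (unitRatioSeries α β γ s m) := by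
  have hm : (0 : ℝ) ≤ m := Nat.cast_nonneg m
  have h1 := h.α_pos
  have h2 := h.β_pos
  have h3 := h.γ_pos
  exact ((nonnegCoeff_one_sub_mul_geometricSeries hm (by linarith)).mul
    (nonnegCoeff_geometricSeries (by linarith))).mul
    ((nonnegCoeff_geometricSeries (by linarith)).pow s)

lemma coeff_unitRatioSeries_zero_pos (j : ℕ) :
    0 < PowerSeries.coeff j (unitRatioSeries α β γ s 0) := by
  rw [unitRatioSeries]
  simp only [Nat.cast_zero, map_zero, zero_mul, sub_zero, one_mul, zero_add]
  rw [mul_assoc]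
  refine NonnegCoeff.coeff_mul_pos (fun j => ?_) ((nonnegCoeff_geometricSeries h.β_pos.le).mul
    ((nonnegCoeff_geometricSeries h.γ_pos.le).pow s)) ?_ j
  · rw [geometricSeries, PowerSeries.coeff_mk]
    exact pow_pos h.α_pos _
  · simp [geometricSeries]

omit h in
lemma coeff_zero_inverse (h0 : PowerSeries.coeff 0 A = 1) (hAB : A * B = 1) :
    PowerSeries.coeff 0 B = 1 := by
  have := congrArg (PowerSeries.coeff 0) hAB
  simpa [PowerSeries.coeff_mul, h0] using this

lemma connectedCoeff_zero (hAB : A * B = 1) : connectedCoeff B c α β γ s 0 = 1 := by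
  simpa [connectedCoeff] using coeff_zero_inverse h.coeff_zero hAB

/-- The term `k = 0` only affects the constant coefficient, and all others are nonpositive by
Kaluza's theorem and positivity of the ratio series. The term `k = 1` is strictly negative because
`α > 0` makes every coefficient of `unitRatioSeries` at `m = 0` positive. -/
lemma connectedCoeff_neg (hAB : A * B = 1) {j : ℕ} (hj : s + 1 ≤ j) :
    connectedCoeff B c α β γ s j < 0 := by
  obtain ⟨j, rfl⟩ : ∃ i, j = i + 1 := ⟨j - 1, by omega⟩
  rw [connectedCoeff, Finset.sum_range_succ']
  simp only [Finset.range_zero, Finset.prod_empty, PowerSeries.coeff_one, Nat.succ_ne_zero,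
    if_false, mul_zero, add_zero]
  refine Finset.sum_neg' (fun k _ => ?_) ⟨0, by simp, ?_⟩
  · refine mul_nonpos_of_nonpos_of_nonneg (h.rapidGrowth.coeff_inverse_neg hAB k).le ?_
    rw [coeff_prod_ratioSeries]
    split_ifs
    · exact mul_nonneg (pow_nonneg h.c_pos.le _)
        (NonnegCoeff.prod _ h.nonnegCoeff_unitRatioSeries _)
    · rfl
  · refine mul_neg_of_neg_of_pos (h.rapidGrowth.coeff_inverse_neg hAB 0) ?_
    rw [coeff_prod_ratioSeries, if_pos (by omega)]
    refine mul_pos (pow_pos h.c_pos _) ?_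
    simpa using h.coeff_unitRatioSeries_zero_pos _

omit h in
lemma connectedCoeff_eq_zero {j : ℕ} (hj : 0 < j) (hjs : j < s + 1) :
    connectedCoeff B c α β γ s j = 0 := by
  refine Finset.sum_eq_zero fun k _ => ?_
  rcases k with _ | k
  · simp [PowerSeries.coeff_one, hj.ne']
  · rw [coeff_prod_ratioSeries, if_neg (by nlinarith), mul_zero]

/-- Expansion of the probability `c_n / a_n` of connectedness along the coefficients of `A`. -/
theorem hasAsympExpansion_shift (hAB : A * B = 1) (hC : eulerOp A = eulerOp C * A)
    (hCle : ∀ n, |PowerSeries.coeff n C| ≤ PowerSeries.coeff n A)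
    {t : ℕ → ℕ → ℝ} (ht : ∀ k n, k ≤ n →
      t k n = PowerSeries.coeff k B * (PowerSeries.coeff (n - k) A / PowerSeries.coeff n A)) :
    HasAsympExpansion (fun n => PowerSeries.coeff n C / PowerSeries.coeff n A) t := by
  have hne := fun n => (h.rapidGrowth.pos n).ne'
  -- Bender's error `O(A_{n-r-1})` is `O` of the next term only if the coefficient of that term is
  -- nonzero.
  have hB : ∀ k, PowerSeries.coeff k B ≠ 0 := by
    rintro (_ | k)
    · rw [coeff_zero_inverse h.coeff_zero hAB]; exact one_ne_zero
    · exact (h.rapidGrowth.coeff_inverse_neg hAB k).ne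
  have hev : ∀ k, t k =ᶠ[atTop] fun n => PowerSeries.coeff k B *
      (PowerSeries.coeff (n - k) A / PowerSeries.coeff n A) := fun k => by
    filter_upwards [eventually_ge_atTop k] with n hn using ht k n hn
  refine ⟨fun r => ?_, fun k => ?_⟩
  · have h1 := (h.rapidGrowth.log_isBigO hAB hC hCle (r + 1)).mul
      (isBigO_refl (fun n => (PowerSeries.coeff n A)⁻¹) atTop)
    refine IsBigO.congr' (h1.trans ((isBigO_refl _ _).const_mul_right (hB (r + 1)))) ?_ ?_
    · filter_upwards [eventually_ge_atTop (r + 1)] with n hn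
      rw [sub_mul, Finset.sum_mul, div_eq_mul_inv]
      congr 1
      refine Finset.sum_congr rfl fun k hk => ?_
      rw [ht k n (by have := Finset.mem_range.1 hk; omega), div_eq_mul_inv, mul_assoc]
    · filter_upwards [hev (r + 1)] with n hn
      rw [hn, div_eq_mul_inv]
  · refine IsLittleO.congr' ?_ (hev (k + 1)).symm (hev k).symm
    refine (IsLittleO.const_mul_right (hB k) ?_).const_mul_left _
    -- The quotient of consecutive shifts is at most `K / (n - k)`, which tends to zero.
    obtain ⟨K, hK, hlin⟩ := h.rapidGrowth.exists_linear
    rw [isLittleO_iff]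
    intro ε hε
    have hlim : Tendsto (fun n : ℕ => ((n - (k + 1) : ℕ) : ℝ)) atTop atTop :=
      tendsto_natCast_atTop_atTop.comp (tendsto_sub_atTop_nat (k + 1))
    filter_upwards [eventually_ge_atTop (k + 1), hlim.eventually_ge_atTop (K / ε)] with n hn hn'
    have hp := h.rapidGrowth.pos n
    have hp1 := h.rapidGrowth.pos (n - k)
    have hp2 := h.rapidGrowth.pos (n - (k + 1))
    have hl := hlin (n - (k + 1))
    rw [show n - (k + 1) + 1 = n - k by omega] at hl
    rw [Real.norm_eq_abs, Real.norm_eq_abs, abs_of_pos (div_pos hp2 hp),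
      abs_of_pos (div_pos hp1 hp), ← mul_div_assoc]
    refine div_le_div_of_nonneg_right ?_ hp.le
    rw [div_le_iff₀ hε] at hn'
    refine le_of_mul_le_mul_left ?_ hK
    nlinarith [mul_le_mul_of_nonneg_left hl hε.le]

theorem hasInvExpansion_connected (hAB : A * B = 1) (hC : eulerOp A = eulerOp C * A)
    (hCle : ∀ n, |PowerSeries.coeff n C| ≤ PowerSeries.coeff n A) :
    HasInvExpansion (fun n => PowerSeries.coeff n C / PowerSeries.coeff n A)
      (PowerSeries.mk (connectedCoeff B c α β γ s)) := by
  refine .of_approx fun r => ?_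
  refine ⟨fun n => ∑ k ∈ Finset.range r, PowerSeries.coeff k B *
    (PowerSeries.coeff (n - k) A / PowerSeries.coeff n A),
    ∑ k ∈ Finset.range r, PowerSeries.C (PowerSeries.coeff k B) *
      ∏ m ∈ Finset.range k, ratioSeries c α β γ s m,
    .sum _ fun k _ => (HasInvExpansion.const _).mul (h.hasInvExpansion_shift k), ?_, ?_⟩
  · rw [PowerSeries.X_pow_dvd_iff]
    intro j hj
    rw [map_sub, PowerSeries.coeff_mk, map_sum, sub_eq_zero, connectedCoeff]
    simp only [PowerSeries.coeff_C_mul]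
    -- Since the `k`-fold product is divisible by `X ^ k`, terms with `k > j` do not reach the
    -- coefficient of index `j`.
    refine Finset.sum_subset (Finset.range_mono hj) fun k _ hk => ?_
    rw [Finset.mem_range, not_lt] at hk
    rw [coeff_prod_ratioSeries, if_neg (by nlinarith), mul_zero]
  · have h1 := (h.rapidGrowth.log_isBigO hAB hC hCle r).mul
      (isBigO_refl (fun n => (PowerSeries.coeff n A)⁻¹) atTop)
    have h2 := (h.hasInvExpansion_shift r).isBigO_sub r
    have h3 := PowerSeries.X_pow_dvd_iff.1 (X_pow_dvd_prod_ratioSeries (c := c) (α := α) (β := β)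
      (γ := γ) (s := s) r)
    have h4 : ∀ n : ℕ, ∑ j ∈ Finset.range r, PowerSeries.coeff j
        (∏ m ∈ Finset.range r, ratioSeries c α β γ s m) * ((n : ℝ)⁻¹) ^ j = 0 := fun n =>
      Finset.sum_eq_zero fun j hj => by rw [h3 j (Finset.mem_range.1 hj), zero_mul]
    simp only [h4, sub_zero, div_eq_mul_inv] at h2
    refine (h1.trans h2).congr_left fun n => ?_
    rw [sub_mul, Finset.sum_mul]
    simp only [div_eq_mul_inv, mul_assoc]

end HasRationalRatio

lemma inv_pow_succ_isLittleO (k : ℕ) :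
    (fun n : ℕ => ((n : ℝ)⁻¹) ^ (k + 1)) =o[atTop] fun n : ℕ => ((n : ℝ)⁻¹) ^ k := by
  have h1 : (fun n : ℕ => (n : ℝ)⁻¹) =o[atTop] fun _ : ℕ => (1 : ℝ) :=
    (isLittleO_one_iff ℝ).2 tendsto_inv_atTop_nhds_zero_nat
  simpa [pow_succ] using (isBigO_refl (fun n : ℕ => ((n : ℝ)⁻¹) ^ k) atTop).mul_isLittleO h1

lemma HasInvExpansion.hasAsympExpansion {f : ℕ → ℝ} {e : ℕ → ℝ}
    (h : HasInvExpansion f (PowerSeries.mk e)) (he : ∀ k, e k ≠ 0) :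
    HasAsympExpansion f fun k n => e k / (n : ℝ) ^ k := by
  simp only [div_eq_mul_inv, ← inv_pow]
  refine ⟨fun r => ?_, fun k => ?_⟩
  · simpa using (h.isBigO_sub (r + 1)).trans ((isBigO_refl _ _).const_mul_right (he (r + 1)))
  · exact ((inv_pow_succ_isLittleO k).const_mul_left _).const_mul_right (he k)

/-- A vanishing term cannot serve as a comparison scale, so order one is dropped and term `k ≥ 1`
has order `k + 1`; the error after `r` is therefore taken at order `r + 2`. -/
lemma HasInvExpansion.hasAsympExpansion_skip {f : ℕ → ℝ} {e : ℕ → ℝ}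
    (h : HasInvExpansion f (PowerSeries.mk e)) (he0 : e 0 ≠ 0) (he1 : e 1 = 0)
    (he : ∀ k, e (k + 2) ≠ 0) :
    HasAsympExpansion f
      fun k n => if k = 0 then e 0 else e (k + 1) / (n : ℝ) ^ (k + 1) := by
  simp only [div_eq_mul_inv, ← inv_pow]
  refine ⟨fun r => ?_, fun k => ?_⟩
  · have h1 := (h.isBigO_sub (r + 2)).trans ((isBigO_refl _ _).const_mul_right (he r))
    refine h1.congr (fun n => ?_) (fun n => by simp)
    rw [Finset.sum_range_succ', Finset.sum_range_succ', Finset.sum_range_succ']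
    simp [he1]
  · rcases k with _ | k
    · have h1 := (inv_pow_succ_isLittleO 1).trans_isBigO (inv_pow_isBigO (Nat.zero_le 1))
      simpa using (h1.const_mul_left (e 2)).const_mul_right he0
    · simpa using ((inv_pow_succ_isLittleO (k + 2)).const_mul_left (e (k + 3))).const_mul_right
        (he k)

/-! ### Numerical values of the first coefficients -/

section Values

lemma coeff_zero_mul' (F G : ℝ⟦X⟧) : PowerSeries.coeff 0 (F * G) =
    PowerSeries.coeff 0 F * PowerSeries.coeff 0 G := by
  simp [PowerSeries.coeff_mul]

lemma coeff_one_mul' (F G : ℝ⟦X⟧) : PowerSeries.coeff 1 (F * G) =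
    PowerSeries.coeff 0 F * PowerSeries.coeff 1 G +
      PowerSeries.coeff 1 F * PowerSeries.coeff 0 G := by
  simp [PowerSeries.coeff_mul, Finset.Nat.antidiagonal_succ]

lemma coeff_two_mul' (F G : ℝ⟦X⟧) : PowerSeries.coeff 2 (F * G) =
    PowerSeries.coeff 0 F * PowerSeries.coeff 2 G +
      PowerSeries.coeff 1 F * PowerSeries.coeff 1 G +
      PowerSeries.coeff 2 F * PowerSeries.coeff 0 G := by
  simp [PowerSeries.coeff_mul, Finset.Nat.antidiagonal_succ]; ring

lemma coeff_three_mul' (F G : ℝ⟦X⟧) : PowerSeries.coeff 3 (F * G) =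
    PowerSeries.coeff 0 F * PowerSeries.coeff 3 G +
      PowerSeries.coeff 1 F * PowerSeries.coeff 2 G +
      PowerSeries.coeff 2 F * PowerSeries.coeff 1 G +
      PowerSeries.coeff 3 F * PowerSeries.coeff 0 G := by
  simp [PowerSeries.coeff_mul, Finset.Nat.antidiagonal_succ]; ring

lemma coeff_four_mul' (F G : ℝ⟦X⟧) : PowerSeries.coeff 4 (F * G) =
    PowerSeries.coeff 0 F * PowerSeries.coeff 4 G +
      PowerSeries.coeff 1 F * PowerSeries.coeff 3 G +
      PowerSeries.coeff 2 F * PowerSeries.coeff 2 G +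
      PowerSeries.coeff 3 F * PowerSeries.coeff 1 G +
      PowerSeries.coeff 4 F * PowerSeries.coeff 0 G := by
  simp [PowerSeries.coeff_mul, Finset.Nat.antidiagonal_succ]; ring

lemma coeff_one_sub_C_mul_X (a : ℝ) (j : ℕ) :
    PowerSeries.coeff j (1 - PowerSeries.C a * PowerSeries.X) =
      if j = 0 then 1 else if j = 1 then -a else 0 := by
  rw [map_sub, PowerSeries.coeff_C_mul, PowerSeries.coeff_one, PowerSeries.coeff_X]
  rcases j with _ | _ | j <;> simp

variable {A B : ℝ⟦X⟧} {c α β γ : ℝ} {s : ℕ}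

/-- The first coefficients of the inverse of `A`. -/
lemma coeff_inverse_values (h0 : PowerSeries.coeff 0 A = 1) (hAB : A * B = 1) :
    PowerSeries.coeff 0 B = 1 ∧
    PowerSeries.coeff 1 B = -PowerSeries.coeff 1 A ∧
    PowerSeries.coeff 2 B = -PowerSeries.coeff 2 A -
      PowerSeries.coeff 1 A * PowerSeries.coeff 1 B ∧
    PowerSeries.coeff 3 B = -PowerSeries.coeff 3 A -
      PowerSeries.coeff 2 A * PowerSeries.coeff 1 B -
      PowerSeries.coeff 1 A * PowerSeries.coeff 2 B ∧
    PowerSeries.coeff 4 B = -PowerSeries.coeff 4 A -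
      PowerSeries.coeff 3 A * PowerSeries.coeff 1 B -
      PowerSeries.coeff 2 A * PowerSeries.coeff 2 B -
      PowerSeries.coeff 1 A * PowerSeries.coeff 3 B := by
  have e := fun j => congrArg (PowerSeries.coeff j) hAB
  have e0 := e 0
  have e1 := e 1
  have e2 := e 2
  have e3 := e 3
  have e4 := e 4
  rw [coeff_zero_mul', h0, PowerSeries.coeff_one, if_pos rfl] at e0
  rw [coeff_one_mul', h0, PowerSeries.coeff_one, if_neg (by norm_num)] at e1
  rw [coeff_two_mul', h0, PowerSeries.coeff_one, if_neg (by norm_num)] at e2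
  rw [coeff_three_mul', h0, PowerSeries.coeff_one, if_neg (by norm_num)] at e3
  rw [coeff_four_mul', h0, PowerSeries.coeff_one, if_neg (by norm_num)] at e4
  have f0 : PowerSeries.coeff 0 B = 1 := by linarith
  rw [f0] at e1 e2 e3 e4
  refine ⟨f0, ?_, ?_, ?_, ?_⟩ <;> linarith

lemma HasRationalRatio.coeff_values (h : HasRationalRatio A c α β γ s) :
    PowerSeries.coeff 1 A = (1 - α) * (1 - β) * (1 - γ) ^ s / c ∧
    PowerSeries.coeff 2 A =
      PowerSeries.coeff 1 A * ((2 - α) * (2 - β) * (2 - γ) ^ s) / (2 * c) ∧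
    PowerSeries.coeff 3 A =
      PowerSeries.coeff 2 A * ((3 - α) * (3 - β) * (3 - γ) ^ s) / (3 * c) ∧
    PowerSeries.coeff 4 A =
      PowerSeries.coeff 3 A * ((4 - α) * (4 - β) * (4 - γ) ^ s) / (4 * c) := by
  have hc := h.c_pos
  have r0 := h.ratio 0
  have r1 := h.ratio 1
  have r2 := h.ratio 2
  have r3 := h.ratio 3
  rw [h.coeff_zero] at r0
  norm_num at r0 r1 r2 r3
  refine ⟨?_, ?_, ?_, ?_⟩ <;> rw [eq_div_iff (by positivity)] <;> linarith

lemma connectedCoeff_values_linear :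
    connectedCoeff B c α β γ 0 1 = PowerSeries.coeff 1 B * c ∧
    connectedCoeff B c α β γ 0 2 = PowerSeries.coeff 1 B * c * (α + β) +
      PowerSeries.coeff 2 B * c ^ 2 ∧
    connectedCoeff B c α β γ 0 3 = PowerSeries.coeff 1 B * c * (α ^ 2 + α * β + β ^ 2) +
      PowerSeries.coeff 2 B * c ^ 2 * (2 * α + 2 * β + 1) + PowerSeries.coeff 3 B * c ^ 3 ∧
    connectedCoeff B c α β γ 0 4 =
      PowerSeries.coeff 1 B * c * (α ^ 3 + α ^ 2 * β + α * β ^ 2 + β ^ 3) +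
      PowerSeries.coeff 2 B * c ^ 2 * (3 * α ^ 2 + 4 * α * β + 3 * β ^ 2 + 3 * α + 3 * β + 1) +
      PowerSeries.coeff 3 B * c ^ 3 * (3 * α + 3 * β + 3) +
      PowerSeries.coeff 4 B * c ^ 4 := by
  have h2 : PowerSeries.coeff 0 (2 : ℝ⟦X⟧) = 2 := by
    simpa using map_ofNat (PowerSeries.constantCoeff (R := ℝ)) 2
  refine ⟨?_, ?_, ?_, ?_⟩ <;>
  · simp only [connectedCoeff, Finset.sum_range_succ, Finset.sum_range_zero,
      HasRationalRatio.coeff_prod_ratioSeries]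
    norm_num [Finset.prod_range_succ, unitRatioSeries, coeff_zero_mul', coeff_one_mul',
      coeff_two_mul', coeff_three_mul', geometricSeries, coeff_one_sub_C_mul_X,
      PowerSeries.coeff_one, PowerSeries.coeff_X, h2, -PowerSeries.coeff_zero_eq_constantCoeff]
    try ring

lemma connectedCoeff_values_quadratic :
    connectedCoeff B c α α α 1 2 = PowerSeries.coeff 1 B * c ∧
    connectedCoeff B c α α α 1 3 = PowerSeries.coeff 1 B * c * (3 * α) ∧
    connectedCoeff B c α α α 1 4 = PowerSeries.coeff 1 B * c * (6 * α ^ 2) +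
      PowerSeries.coeff 2 B * c ^ 2 ∧
    connectedCoeff B c α α α 1 5 = PowerSeries.coeff 1 B * c * (10 * α ^ 3) +
      PowerSeries.coeff 2 B * c ^ 2 * (6 * α + 2) := by
  have h2 : PowerSeries.coeff 0 (2 : ℝ⟦X⟧) = 2 := by
    simpa using map_ofNat (PowerSeries.constantCoeff (R := ℝ)) 2
  refine ⟨?_, ?_, ?_, ?_⟩ <;>
  · simp only [connectedCoeff, Finset.sum_range_succ, Finset.sum_range_zero,
      HasRationalRatio.coeff_prod_ratioSeries]
    norm_num [Finset.prod_range_succ, unitRatioSeries, coeff_zero_mul', coeff_one_mul',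
      coeff_two_mul', coeff_three_mul', geometricSeries, coeff_one_sub_C_mul_X,
      PowerSeries.coeff_one, PowerSeries.coeff_X, h2, -PowerSeries.coeff_zero_eq_constantCoeff]
    try ring

theorem connectedCoeff_triangulated (h : HasRationalRatio A (1 / 54) (1 / 6) (5 / 6) γ 0)
    (hAB : A * B = 1) :
    connectedCoeff B (1 / 54) (1 / 6) (5 / 6) γ 0 1 = -(5 / 36) ∧
    connectedCoeff B (1 / 54) (1 / 6) (5 / 6) γ 0 2 = -(695 / 2592) ∧
    connectedCoeff B (1 / 54) (1 / 6) (5 / 6) γ 0 3 = -(216305 / 279936) := by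
  obtain ⟨a1, a2, a3, -⟩ := h.coeff_values
  obtain ⟨-, b1, b2, b3, -⟩ := coeff_inverse_values h.coeff_zero hAB
  obtain ⟨e1, e2, e3, -⟩ := connectedCoeff_values_linear (B := B) (c := 1 / 54) (α := 1 / 6)
    (β := 5 / 6) (γ := γ)
  rw [e1, e2, e3, b3, b2, b1, a3, a2, a1]
  norm_num

theorem connectedCoeff_quadrangulated (h : HasRationalRatio A (1 / 16) (1 / 4) (3 / 4) γ 0)
    (hAB : A * B = 1) :
    connectedCoeff B (1 / 16) (1 / 4) (3 / 4) γ 0 1 = -(3 / 16) ∧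
    connectedCoeff B (1 / 16) (1 / 4) (3 / 4) γ 0 2 = -(183 / 512) ∧
    connectedCoeff B (1 / 16) (1 / 4) (3 / 4) γ 0 3 = -(8313 / 8192) := by
  obtain ⟨a1, a2, a3, -⟩ := h.coeff_values
  obtain ⟨-, b1, b2, b3, -⟩ := coeff_inverse_values h.coeff_zero hAB
  obtain ⟨e1, e2, e3, -⟩ := connectedCoeff_values_linear (B := B) (c := 1 / 16) (α := 1 / 4)
    (β := 3 / 4) (γ := γ)
  rw [e1, e2, e3, b3, b2, b1, a3, a2, a1]
  norm_num

theorem connectedCoeff_squareTiled (h : HasRationalRatio A (1 / 4) (1 / 2) (1 / 2) γ 0)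
    (hAB : A * B = 1) :
    connectedCoeff B (1 / 4) (1 / 2) (1 / 2) γ 0 1 = -(1 / 4) ∧
    connectedCoeff B (1 / 4) (1 / 2) (1 / 2) γ 0 2 = -(15 / 32) ∧
    connectedCoeff B (1 / 4) (1 / 2) (1 / 2) γ 0 3 = -(167 / 128) ∧
    connectedCoeff B (1 / 4) (1 / 2) (1 / 2) γ 0 4 = -(11845 / 2048) := by
  obtain ⟨a1, a2, a3, a4⟩ := h.coeff_values
  obtain ⟨-, b1, b2, b3, b4⟩ := coeff_inverse_values h.coeff_zero hAB
  obtain ⟨e1, e2, e3, e4⟩ := connectedCoeff_values_linear (B := B) (c := 1 / 4) (α := 1 / 2)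
    (β := 1 / 2) (γ := γ)
  rw [e1, e2, e3, e4, b4, b3, b2, b1, a4, a3, a2, a1]
  norm_num

theorem connectedCoeff_gem (h : HasRationalRatio A (1 / 4) (1 / 2) (1 / 2) (1 / 2) 1)
    (hAB : A * B = 1) :
    connectedCoeff B (1 / 4) (1 / 2) (1 / 2) (1 / 2) 1 2 = -(1 / 8) ∧
    connectedCoeff B (1 / 4) (1 / 2) (1 / 2) (1 / 2) 1 3 = -(3 / 16) ∧
    connectedCoeff B (1 / 4) (1 / 2) (1 / 2) (1 / 2) 1 4 = -(49 / 128) ∧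
    connectedCoeff B (1 / 4) (1 / 2) (1 / 2) (1 / 2) 1 5 = -(145 / 128) := by
  obtain ⟨a1, a2, -, -⟩ := h.coeff_values
  obtain ⟨-, b1, b2, -, -⟩ := coeff_inverse_values h.coeff_zero hAB
  obtain ⟨e2, e3, e4, e5⟩ := connectedCoeff_values_quadratic (B := B) (c := 1 / 4) (α := 1 / 2)
  rw [e2, e3, e4, e5, b2, b1, a2, a1]
  norm_num

end Values

/-! ### Perfect matchings preserving a coloring -/

/-- Perfect matchings of `T` preserving the coloring `κ`. -/
abbrev ColoredMatching {T ι : Type} (κ : T → ι) : Type :=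
  {α : Equiv.Perm T // IsPerfectMatching α ∧ ∀ t, κ (α t) = κ t}

/-- No nonempty proper subset of `V` is closed under the moves `π t → π (α t)`. -/
def IsConnectedMatching {T V : Type} (π : T → V) (α : Equiv.Perm T) : Prop :=
  Nonempty V ∧ ∀ S : Set V, S.Nonempty → (∀ t, π t ∈ S → π (α t) ∈ S) → S = Set.univ

lemma IsPerfectMatching.closed_iff {T : Type} {α : Equiv.Perm T} (h : IsPerfectMatching α)
    {p : T → Prop} (hp : ∀ t, p t → p (α t)) (t : T) : p (α t) ↔ p t :=
  ⟨fun ht => by simpa [(h t).2] using hp _ ht, hp t⟩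

namespace ColoredMatching

/-- Transport of colored perfect matchings. -/
def congr {T T' ι : Type} {κ : T → ι} {κ' : T' → ι} (e : T ≃ T') (h : ∀ t, κ' (e t) = κ t) :
    ColoredMatching κ ≃ ColoredMatching κ' :=
  Equiv.subtypeEquiv e.permCongr fun α => by
    refine and_congr ⟨fun hα t => ?_, fun hα t => ?_⟩ ⟨fun hα t => ?_, fun hα t => ?_⟩
    · have := hα (e.symm t)
      simp only [Equiv.permCongr_apply, Equiv.symm_apply_apply, this.2, Equiv.apply_symm_apply,
        and_true]
      rw [ne_eq, ← Equiv.eq_symm_apply]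
      exact this.1
    · have := hα (e t)
      simpa [Equiv.permCongr_apply] using this
    · rw [Equiv.permCongr_apply, h, hα, ← h, Equiv.apply_symm_apply]
    · have := hα (e t)
      simpa [Equiv.permCongr_apply, h] using this

/-- A colored perfect matching for which `p` is closed is a pair of colored perfect matchings, of
`p` and of its complement. -/
def split {T ι : Type} (κ : T → ι) (p : T → Prop) [DecidablePred p] :
    {x : ColoredMatching κ // ∀ t, p t → p (x.1 t)} ≃
      ColoredMatching (fun t : {t // p t} => κ t) ×
        ColoredMatching (fun t : {t // ¬ p t} => κ t) where
  toFun x :=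
    (⟨x.1.1.subtypePerm fun t => x.1.2.1.closed_iff x.2 t,
      fun t => ⟨fun h => (x.1.2.1 t).1 (congrArg Subtype.val h), Subtype.ext (x.1.2.1 t).2⟩,
      fun t => x.1.2.2 t⟩,
    ⟨x.1.1.subtypePerm fun t => not_congr (x.1.2.1.closed_iff x.2 t),
      fun t => ⟨fun h => (x.1.2.1 t).1 (congrArg Subtype.val h), Subtype.ext (x.1.2.1 t).2⟩,
      fun t => x.1.2.2 t⟩)
  invFun z := ⟨⟨Equiv.Perm.subtypeCongr z.1.1 z.2.1, by
      refine ⟨fun t => ?_, fun t => ?_⟩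
      · by_cases ht : p t
        · rw [Equiv.Perm.subtypeCongr.left_apply _ _ ht,
            Equiv.Perm.subtypeCongr.left_apply_subtype, (z.1.2.1 _).2]
          exact ⟨fun h => (z.1.2.1 ⟨t, ht⟩).1 (Subtype.ext h), rfl⟩
        · rw [Equiv.Perm.subtypeCongr.right_apply _ _ ht,
            Equiv.Perm.subtypeCongr.right_apply_subtype, (z.2.2.1 _).2]
          exact ⟨fun h => (z.2.2.1 ⟨t, ht⟩).1 (Subtype.ext h), rfl⟩
      · by_cases ht : p t
        · rw [Equiv.Perm.subtypeCongr.left_apply _ _ ht]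
          exact z.1.2.2 ⟨t, ht⟩
        · rw [Equiv.Perm.subtypeCongr.right_apply _ _ ht]
          exact z.2.2.2 ⟨t, ht⟩⟩, fun t ht => by
      rw [Equiv.Perm.subtypeCongr.left_apply _ _ ht]
      exact (z.1.1 ⟨t, ht⟩).2⟩
  left_inv x := by
    refine Subtype.ext (Subtype.ext (Equiv.ext fun t => ?_))
    by_cases ht : p t
    · rw [Equiv.Perm.subtypeCongr.left_apply _ _ ht]; rfl
    · rw [Equiv.Perm.subtypeCongr.right_apply _ _ ht]; rfl
  right_inv z := by
    refine Prod.ext (Subtype.ext (Equiv.ext fun t => Subtype.ext ?_))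
      (Subtype.ext (Equiv.ext fun t => Subtype.ext ?_))
    · exact Equiv.Perm.subtypeCongr.left_apply_subtype _ _ t
    · exact Equiv.Perm.subtypeCongr.right_apply_subtype _ _ t

end ColoredMatching

lemma isConnectedMatching_congr {T T' V V' : Type} {π : T → V} {π' : T' → V'} (e : T ≃ T')
    (eV : V ≃ V') (h : ∀ t, π' (e t) = eV (π t)) (α : Equiv.Perm T) :
    IsConnectedMatching π α ↔ IsConnectedMatching π' (e.permCongr α) := by
  refine and_congr eV.nonempty_congr ⟨fun hα S hS hcl => ?_, fun hα S hS hcl => ?_⟩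
  · have := hα (eV ⁻¹' S) (hS.preimage eV.surjective) fun t ht => by
      have := hcl (e t) (by rw [h]; exact ht)
      simpa [Equiv.permCongr_apply, h] using this
    rw [Set.preimage_eq_univ_iff, eV.surjective.range_eq, Set.univ_subset_iff] at this
    exact this
  · have := hα (eV.symm ⁻¹' S) (hS.preimage eV.symm.surjective) fun t ht => by
      have h' : ∀ t, eV.symm (π' t) = π (e.symm t) := fun t => by
        rw [Equiv.symm_apply_eq, ← h, Equiv.apply_symm_apply]
      rw [Set.mem_preimage, h'] at ht ⊢
      simpa [Equiv.permCongr_apply] using hcl _ ht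
    rw [Set.preimage_eq_univ_iff, eV.symm.surjective.range_eq, Set.univ_subset_iff] at this
    exact this

/-! ### Components of a matching -/

section Components

/-- The smallest closed set of labels containing `v`. -/
def matchingComponent {T V : Type} (π : T → V) (α : Equiv.Perm T) (v : V) : Set V :=
  {w | ∀ S : Set V, v ∈ S → (∀ t, π t ∈ S → π (α t) ∈ S) → w ∈ S}

variable {T V ι : Type} (π : T → V)

lemma mem_matchingComponent (α : Equiv.Perm T) (v : V) : v ∈ matchingComponent π α v :=
  fun _ hv _ => hv

lemma matchingComponent_closed (α : Equiv.Perm T) (v : V) (t : T)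
    (ht : π t ∈ matchingComponent π α v) : π (α t) ∈ matchingComponent π α v :=
  fun S hv hS => hS t (ht S hv hS)

/-- A matching is an involution, so complements of closed sets are closed. Hence a closed set
meeting the component of `v` must contain `v`, and then the whole component. -/
lemma matchingComponent_eq_iff {α : Equiv.Perm T} (hα : IsPerfectMatching α) (S : Finset V)
    (v : V) (hv : v ∈ S) (hS : ∀ t, π t ∈ S → π (α t) ∈ S) :
    matchingComponent π α v = S ↔ IsConnectedMatching
      (fun t : {t // π t ∈ S} => (⟨π t, t.2⟩ : {v // v ∈ S}))
      (α.subtypePerm fun t => hα.closed_iff (p := fun t => π t ∈ S) hS t) := by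
  constructor
  · refine fun h => ⟨⟨⟨v, hv⟩⟩, fun R hR hcl => ?_⟩
    have hR' : ∀ t, π t ∈ Subtype.val '' R → π (α t) ∈ Subtype.val '' R := by
      rintro t ⟨w, hw, hwt⟩
      have hts : π t ∈ S := hwt ▸ w.2
      exact ⟨_, hcl ⟨t, hts⟩ (by convert hw using 1; exact Subtype.ext hwt.symm), rfl⟩
    have hvR : (⟨v, hv⟩ : {v // v ∈ S}) ∈ R := by
      by_contra hvR
      obtain ⟨w, hw⟩ := hR
      have hwS : (w : V) ∈ matchingComponent π α v := by rw [h]; exact w.2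
      -- If `v` were outside `R`, the complement would be a closed set containing `v` but missing a
      -- point of its component.
      refine hwS (Subtype.val '' R)ᶜ ?_ ?_ ⟨w, hw, rfl⟩
      · rintro ⟨w', hw', hwv⟩
        exact hvR (by convert hw'; exact hwv.symm)
      · intro t ht ht'
        exact ht ((hα.closed_iff (p := fun t => π t ∈ Subtype.val '' R) hR' t).1 ht')
    refine Set.eq_univ_of_forall fun w => ?_
    have hwS : (w : V) ∈ matchingComponent π α v := by rw [h]; exact w.2
    obtain ⟨w', hw', hww⟩ : (w : V) ∈ Subtype.val '' R := hwS _ ⟨_, hvR, rfl⟩ hR'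
    rwa [← Subtype.ext hww]
  · rintro ⟨-, h⟩
    have hsub : matchingComponent π α v ⊆ S := fun w hw => hw S hv hS
    refine Set.Subset.antisymm hsub fun w hw => ?_
    have := h (Subtype.val ⁻¹' matchingComponent π α v)
      ⟨⟨v, hv⟩, mem_matchingComponent π α v⟩
      fun t ht => matchingComponent_closed π α v t ht
    exact (Set.eq_univ_iff_forall.1 this ⟨w, hw⟩ :)

end Components

/-! ### Counting by the component of a marked label -/

section Counting

variable {Q ι : Type} (κ : Q → ι)

/-- Number of colored matchings of `n` labeled copies of `Q`. -/
noncomputable def matchingCount (n : ℕ) : ℕ := Nat.card (ColoredMatching fun t : Fin n × Q => κ t.2)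

/-- Number of connected colored matchings of `n` labeled copies of `Q`. -/
noncomputable def connectedMatchingCount (n : ℕ) : ℕ :=
  Nat.card {x : ColoredMatching fun t : Fin n × Q => κ t.2 // IsConnectedMatching Prod.fst x.1}

lemma connectedMatchingCount_le [Finite Q] (n : ℕ) : connectedMatchingCount κ n ≤ matchingCount κ n :=
  Nat.card_le_card_of_injective _ Subtype.val_injective

lemma card_coloredMatching_subtype {n k : ℕ} (p : Fin n → Prop) (hp : Nat.card {i // p i} = k) :
    Nat.card (ColoredMatching fun t : {t : Fin n × Q // p t.1} => κ t.1.2) =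
      matchingCount κ k := by
  have e : {i // p i} ≃ Fin k := Finite.equivFinOfCardEq hp
  exact Nat.card_congr (ColoredMatching.congr
    (Equiv.prodSubtypeFstEquivSubtypeProd.trans (e.prodCongr (Equiv.refl Q))) fun t => rfl)

lemma card_connectedMatching_subtype {n : ℕ} (S : Finset (Fin n)) :
    Nat.card {x : ColoredMatching fun t : {t : Fin n × Q // t.1 ∈ S} => κ t.1.2 //
      IsConnectedMatching (fun t => (⟨t.1.1, t.2⟩ : {i // i ∈ S})) x.1} =
      connectedMatchingCount κ S.card := by
  have e : {i // i ∈ S} ≃ Fin S.card := S.equivFin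
  refine Nat.card_congr (Equiv.subtypeEquiv (ColoredMatching.congr
    (Equiv.prodSubtypeFstEquivSubtypeProd.trans (e.prodCongr (Equiv.refl Q))) fun t => rfl) ?_)
  intro x
  exact isConnectedMatching_congr
    (Equiv.prodSubtypeFstEquivSubtypeProd.trans (e.prodCongr (Equiv.refl Q))) e (fun t => rfl) x.1

/-- Decomposition of a matching with a marked label into the component of the marked label and
the rest. -/
theorem mul_matchingCount [Finite Q] (n : ℕ) : n * matchingCount κ n =
    ∑ k ∈ Finset.range (n + 1), n.choose k *
      (k * (connectedMatchingCount κ k * matchingCount κ (n - k))) := by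
  classical
  let M := ColoredMatching fun t : Fin n × Q => κ t.2
  let f : Fin n × M → Finset (Fin n) := fun y =>
    Finset.univ.filter (· ∈ matchingComponent Prod.fst y.2.1 y.1)
  have hf : ∀ y S, f y = S ↔ matchingComponent Prod.fst y.2.1 y.1 = (S : Set (Fin n)) := by
    intro y S
    rw [← Finset.coe_inj]
    simp [f]
  -- Objects with a marked label are sorted by the component `S` of the mark. Over `S` there remain
  -- the choice of the mark in `S`, a connected matching on `S`, and an arbitrary matching on the
  -- complement.
  have hfib : ∀ S : Finset (Fin n), Nat.card {y // f y = S} =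
      S.card * (connectedMatchingCount κ S.card * matchingCount κ (n - S.card)) := by
    intro S
    have hcl : ∀ y : Fin n × M, f y = S → ∀ t : Fin n × Q, t.1 ∈ S → (y.2.1 t).1 ∈ S := by
      intro y hy t ht
      rw [hf] at hy
      rw [← Finset.mem_coe, ← hy] at ht ⊢
      exact matchingComponent_closed Prod.fst y.2.1 y.1 t ht
    have hmem : ∀ y : Fin n × M, f y = S → y.1 ∈ S := by
      intro y hy
      rw [hf] at hy
      rw [← Finset.mem_coe, ← hy]
      exact mem_matchingComponent _ _ _
    let sp := ColoredMatching.split (fun t : Fin n × Q => κ t.2) (fun t => t.1 ∈ S)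
    let e : {y // f y = S} ≃ {i // i ∈ S} ×
        ({x : ColoredMatching fun t : {t : Fin n × Q // t.1 ∈ S} => κ t.1.2 //
          IsConnectedMatching (fun t => (⟨t.1.1, t.2⟩ : {i // i ∈ S})) x.1} ×
        ColoredMatching fun t : {t : Fin n × Q // ¬ t.1 ∈ S} => κ t.1.2) :=
      { toFun := fun y => (⟨y.1.1, hmem _ y.2⟩,
          (⟨(sp ⟨y.1.2, hcl _ y.2⟩).1, (matchingComponent_eq_iff Prod.fst y.1.2.2.1 S y.1.1
            (hmem _ y.2) (hcl _ y.2)).1 ((hf _ _).1 y.2)⟩, (sp ⟨y.1.2, hcl _ y.2⟩).2))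
        invFun := fun z => ⟨(z.1.1, (sp.symm (z.2.1.1, z.2.2)).1), by
          rw [hf]
          refine (matchingComponent_eq_iff Prod.fst (sp.symm (z.2.1.1, z.2.2)).1.2.1 S z.1.1
            z.1.2 (sp.symm (z.2.1.1, z.2.2)).2).2 ?_
          have h1 : (sp (sp.symm (z.2.1.1, z.2.2))).1 = z.2.1.1 := by
            rw [Equiv.apply_symm_apply]
          have h2 := z.2.1.2
          rw [← h1] at h2
          exact h2⟩
        left_inv := fun y => by simp
        right_inv := fun z => by simp }
    rw [Nat.card_congr e, Nat.card_prod, Nat.card_prod, card_connectedMatching_subtype,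
      card_coloredMatching_subtype κ (fun i => i ∉ S) (k := n - S.card)]
    · simp
    · simp [Fintype.card_subtype_compl]
  have h1 : Nat.card (Fin n × M) = ∑ S : Finset (Fin n), Nat.card {y // f y = S} := by
    rw [← Nat.card_congr (Equiv.sigmaFiberEquiv f), Nat.card_sigma]
  rw [Nat.card_prod, Nat.card_fin] at h1
  rw [matchingCount, h1, Finset.sum_congr rfl fun S _ => hfib S, ← Finset.powerset_univ,
    Finset.sum_powerset_apply_card (fun k =>
      k * (connectedMatchingCount κ k * matchingCount κ (n - k)))]
  simp

end Counting

/-! ### The number of perfect matchings -/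

section PerfectMatchings

lemma isPerfectMatching_iff_cycleType {T : Type} [Fintype T] [DecidableEq T] (α : Equiv.Perm T)
    {n : ℕ} (hT : Fintype.card T = 2 * n) :
    IsPerfectMatching α ↔ α.cycleType = Multiset.replicate n 2 := by
  have hsq : (∀ s, α (α s) = s) ↔ ∀ c ∈ α.cycleType, c = 2 := by
    have : Fact (Nat.Prime 2) := ⟨Nat.prime_two⟩
    rw [← Equiv.Perm.pow_prime_eq_one_iff, Equiv.ext_iff]
    simp [pow_two]
  have hsum := α.sum_cycleType
  constructor
  · intro h
    have h2 := hsq.1 fun s => (h s).2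
    have hsupp : α.support = Finset.univ :=
      Finset.eq_univ_of_forall fun s => Equiv.Perm.mem_support.2 (h s).1
    have h3 := Multiset.eq_replicate_card.2 h2
    rw [h3, Multiset.sum_replicate, hsupp, Finset.card_univ, hT, smul_eq_mul] at hsum
    rw [h3, show Multiset.card α.cycleType = n by omega]
  · intro h s
    have h2 : ∀ c ∈ α.cycleType, c = 2 := by
      rw [h]; exact fun c hc => Multiset.eq_of_mem_replicate hc
    rw [h, Multiset.sum_replicate, smul_eq_mul, mul_comm, ← hT] at hsum
    have hsupp := Finset.eq_univ_of_card _ hsum.symm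
    exact ⟨Equiv.Perm.mem_support.1 (hsupp ▸ Finset.mem_univ s), hsq.2 h2 s⟩

/-- Perfect matchings are the permutations with `n` cycles of length two, so the count of a
conjugacy class gives `(2n)! / (2 ^ n n!)`. -/
lemma card_perfectMatching_even {T : Type} [Finite T] {n : ℕ} (hT : Nat.card T = 2 * n) :
    Nat.card {α : Equiv.Perm T // IsPerfectMatching α} = (2 * n - 1)‼ := by
  classical
  have := Fintype.ofFinite T
  rw [Nat.card_eq_fintype_card] at hT
  have h1 := Equiv.Perm.card_of_cycleType_mul_eq T (Multiset.replicate n 2)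
  rw [Multiset.sum_replicate, Multiset.prod_replicate, smul_eq_mul, hT, if_pos
    ⟨by omega, fun a ha => (Multiset.eq_of_mem_replicate ha).ge⟩, mul_comm n 2, Nat.sub_self,
    Nat.factorial_zero, one_mul] at h1
  have h2 : ∏ a ∈ (Multiset.replicate n 2).toFinset, ((Multiset.replicate n 2).count a)! = n ! := by
    rcases n with _ | n
    · simp
    · rw [Multiset.toFinset_replicate, if_neg (by omega)]
      simp
  have h3 : (2 * n)! = (2 * n - 1)‼ * (2 ^ n * n !) := by
    rw [← Nat.doubleFactorial_two_mul]
    rcases n with _ | n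
    · simp
    · rw [show 2 * (n + 1) = 2 * n + 1 + 1 by ring, Nat.factorial_eq_mul_doubleFactorial]
      rw [Nat.add_sub_cancel, mul_comm]
  rw [h2, h3] at h1
  have h4 := Nat.eq_of_mul_eq_mul_right (by positivity) h1
  rw [← h4, Nat.card_eq_fintype_card, Fintype.card_subtype]
  simp only [isPerfectMatching_iff_cycleType _ hT]

lemma card_perfectMatching_odd {T : Type} [Finite T] (hT : Odd (Nat.card T)) :
    Nat.card {α : Equiv.Perm T // IsPerfectMatching α} = 0 := by
  classical
  have := Fintype.ofFinite T
  rw [Nat.card_eq_fintype_card] at hT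
  rw [Nat.card_eq_zero]
  refine Or.inl ⟨fun ⟨α, h⟩ => ?_⟩
  have : Fact (Nat.Prime 2) := ⟨Nat.prime_two⟩
  have h2 : ∀ c ∈ α.cycleType, c = 2 := by
    rw [← Equiv.Perm.pow_prime_eq_one_iff, Equiv.ext_iff]
    simpa [pow_two] using fun s => (h s).2
  have hsupp : α.support = Finset.univ :=
    Finset.eq_univ_of_forall fun s => Equiv.Perm.mem_support.2 (h s).1
  have hsum := α.sum_cycleType
  rw [Multiset.eq_replicate_card.2 h2, Multiset.sum_replicate, hsupp, Finset.card_univ,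
    smul_eq_mul] at hsum
  rw [← hsum] at hT
  exact (Nat.not_odd_iff_even.2 (even_two.mul_left _)) hT

end PerfectMatchings

/-! ### Connectedness of glued spaces -/

/-- A space glued from connected cells `{v} × K` along a relation inducing the moves
`π t → π (α t)` on labels is connected iff these moves are transitive. -/
theorem connectedSpace_quot_iff {T V K : Type} [TopologicalSpace V] [DiscreteTopology V]
    [TopologicalSpace K] [ConnectedSpace K] {π : T → V} {α : Equiv.Perm T}
    (hα : IsPerfectMatching α) {r : V × K → V × K → Prop}
    (hr : ∀ x y, r x y → ∃ t, π t = x.1 ∧ π (α t) = y.1)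
    (hr' : ∀ t, ∃ x y, r x y ∧ x.1 = π t ∧ y.1 = π (α t)) :
    ConnectedSpace (Quot r) ↔ IsConnectedMatching π α := by
  constructor
  · intro h
    obtain ⟨q⟩ := h.toNonempty
    obtain ⟨x₀, -⟩ := Quot.exists_rep q
    refine ⟨⟨x₀.1⟩, fun S hS hcl => ?_⟩
    -- The cells with label in a closed set form a saturated set, hence descend to the quotient,
    -- where they are clopen because labels are discrete.
    have hU : ∀ x y, r x y → (x.1 ∈ S) = (y.1 ∈ S) := fun x y hxy => by
      obtain ⟨t, ht, ht'⟩ := hr x y hxy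
      rw [← ht, ← ht']
      exact propext (hα.closed_iff (p := fun t => π t ∈ S) hcl t).symm
    let U : Set (Quot r) := {q | Quot.lift (fun x : V × K => x.1 ∈ S) hU q}
    have hpre : Quot.mk r ⁻¹' U = Prod.fst ⁻¹' S := rfl
    have hclopen : IsClopen U := by
      constructor
      · rw [← isQuotientMap_quot_mk.isClosed_preimage, hpre]
        exact (isClosed_discrete S).preimage continuous_fst
      · rw [← isQuotientMap_quot_mk.isOpen_preimage, hpre]
        exact (isOpen_discrete S).preimage continuous_fst
    obtain ⟨k⟩ : Nonempty K := inferInstance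
    obtain ⟨v, hv⟩ := hS
    have huniv := hclopen.eq_univ ⟨Quot.mk r (v, k), hv⟩
    exact Set.eq_univ_of_forall fun w =>
      (Set.eq_univ_iff_forall.1 huniv (Quot.mk r (w, k)) :)
  · rintro ⟨⟨v₀⟩, h⟩
    obtain ⟨k₀⟩ : Nonempty K := inferInstance
    have hpre : PreconnectedSpace (Quot r) := by
      refine preconnectedSpace_iff_clopen.2 fun U hU => ?_
      -- A clopen set meeting a connected cell contains it, so clopen sets of the quotient are
      -- described by labels alone.
      have hcell : ∀ v k, Quot.mk r (v, k) ∈ U → ∀ k', Quot.mk r (v, k') ∈ U := by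
        intro v k hk
        have hc : Continuous fun k : K => Quot.mk r (v, k) :=
          continuous_quot_mk.comp (Continuous.prodMk_right v)
        have huniv := (hU.preimage hc).eq_univ ⟨k, hk⟩
        exact fun k' => (Set.eq_univ_iff_forall.1 huniv k' :)
      rcases U.eq_empty_or_nonempty with h0 | ⟨q, hq⟩
      · exact Or.inl h0
      · right
        have hS := h {v | ∀ k, Quot.mk r (v, k) ∈ U}
          (by induction q using Quot.ind with | mk x => exact ⟨x.1, hcell x.1 x.2 hq⟩)
          fun t ht => by
            obtain ⟨x, y, hxy, hx, hy⟩ := hr' t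
            rw [← hx] at ht
            rw [← hy]
            refine hcell y.1 y.2 ?_
            have : Quot.mk r x ∈ U := ht x.2
            rwa [Quot.sound hxy] at this
        refine Set.eq_univ_of_forall fun q => ?_
        induction q using Quot.ind with
        | mk x => exact Set.eq_univ_iff_forall.1 hS x.1 x.2
    exact { hpre with toNonempty := ⟨Quot.mk r (v₀, k₀)⟩ }

lemma polygonVertex_mem (p k : ℕ) : polygonVertex p k ∈ polygon p :=
  subset_convexHull ℝ _ ⟨k, rfl⟩

instance polygon_connectedSpace (p : ℕ) : ConnectedSpace (polygon p) :=
  isConnected_iff_connectedSpace.1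
    ((convex_convexHull ℝ _).isConnected ⟨_, polygonVertex_mem p 0⟩)

theorem connectedSpace_gluedSurface_iff {p n : ℕ} {α : Equiv.Perm (Fin n × Fin p)}
    (hα : IsPerfectMatching α) :
    ConnectedSpace (GluedSurface α) ↔ IsConnectedMatching Prod.fst α := by
  -- Parameter `0` provides an identified pair: the start of a side and the end of its partner.
  refine connectedSpace_quot_iff hα (fun x y ⟨s, t, _, hx, _, hy, _⟩ => ⟨s, hx.symm, hy.symm⟩)
    fun s => ⟨(s.1, ⟨polygonVertex p s.2, polygonVertex_mem _ _⟩),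
      ((α s).1, ⟨polygonVertex p ((α s).2 + 1), polygonVertex_mem _ _⟩),
      ⟨s, 0, by simp, rfl, by simp [sidePoint], rfl, by simp [sidePoint]⟩, rfl, rfl⟩

instance stdSimplex_connectedSpace (D : ℕ) : ConnectedSpace (stdSimplex ℝ (Fin (D + 1))) :=
  isConnected_iff_connectedSpace.1
    ((convex_stdSimplex ℝ _).isConnected ⟨_, single_mem_stdSimplex ℝ 0⟩)

/-- The matching of pairs (simplex, color) encoded by a GEM. -/
def GEM.toPerm {D n : ℕ} (g : GEM D n) : Equiv.Perm (Fin n × Fin (D + 1)) where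
  toFun t := ((g t.2).1 t.1, t.2)
  invFun t := ((g t.2).1 t.1, t.2)
  left_inv t := Prod.ext ((g t.2).2 t.1).2 rfl
  right_inv t := Prod.ext ((g t.2).2 t.1).2 rfl

lemma GEM.isPerfectMatching_toPerm {D n : ℕ} (g : GEM D n) : IsPerfectMatching g.toPerm :=
  fun t => ⟨fun h => ((g t.2).2 t.1).1 (congrArg Prod.fst h), Prod.ext ((g t.2).2 t.1).2 rfl⟩

theorem GEM.connectedSpace_iff {D n : ℕ} (hD : 0 < D) (g : GEM D n) :
    ConnectedSpace g.Realization ↔ IsConnectedMatching Prod.fst g.toPerm := by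
  refine connectedSpace_quot_iff g.isPerfectMatching_toPerm
    (fun x y ⟨c, _, hy, _⟩ => ⟨(x.1, c), rfl, hy.symm⟩) fun t => ?_
  -- A vertex of another color lies on the glued facet. In dimension zero facets are empty and
  -- nothing would be glued.
  have : Nontrivial (Fin (D + 1)) := Fin.nontrivial_iff_two_le.2 (by omega)
  obtain ⟨c, hc⟩ := exists_ne t.2
  exact ⟨(t.1, ⟨_, single_mem_stdSimplex ℝ c⟩), ((g t.2).1 t.1, ⟨_, single_mem_stdSimplex ℝ c⟩),
    ⟨t.2, by simp [hc.symm], rfl, rfl⟩, rfl, rfl⟩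

/-- GEMs are matchings of pairs (simplex, color) preserving colors. -/
def GEM.equivColoredMatching (D n : ℕ) :
    GEM D n ≃ ColoredMatching fun t : Fin n × Fin (D + 1) => t.2 where
  toFun g := ⟨g.toPerm, g.isPerfectMatching_toPerm, fun _ => rfl⟩
  invFun x c := ⟨⟨fun i => (x.1 (i, c)).1, fun i => (x.1 (i, c)).1, fun i => by
      have h : ((x.1 (i, c)).1, c) = x.1 (i, c) := Prod.ext rfl (x.2.2 (i, c)).symm
      simp only [h, (x.2.1 (i, c)).2], fun i => by
      have h : ((x.1 (i, c)).1, c) = x.1 (i, c) := Prod.ext rfl (x.2.2 (i, c)).symm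
      simp only [h, (x.2.1 (i, c)).2]⟩, fun i => by
      have h : ((x.1 (i, c)).1, c) = x.1 (i, c) := Prod.ext rfl (x.2.2 (i, c)).symm
      refine ⟨fun hi => (x.2.1 (i, c)).1 (Prod.ext hi (x.2.2 (i, c))), ?_⟩
      simp only [Equiv.coe_fn_mk, h, (x.2.1 (i, c)).2]⟩
  left_inv g := funext fun c => Subtype.ext (Equiv.ext fun i => rfl)
  right_inv x := Subtype.ext (Equiv.ext fun t => Prod.ext rfl (x.2.2 t).symm)

/-! ### From counting to asymptotics -/

/-- If `i + j = p n` and `p` divides `j`, it divides `i`. Support is thus needed for one factor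
only, which spares a study of the support of the inverse series. -/
lemma sum_antidiagonal_mul_of_dvd {p : ℕ} (hp : 0 < p) (f g : ℕ → ℝ)
    (hg : ∀ j, ¬ p ∣ j → g j = 0) (n : ℕ) :
    ∑ ij ∈ Finset.HasAntidiagonal.antidiagonal (p * n), f ij.1 * g ij.2 =
      ∑ ij ∈ Finset.HasAntidiagonal.antidiagonal n, f (p * ij.1) * g (p * ij.2) := by
  symm
  refine Finset.sum_of_injOn (fun ij : ℕ × ℕ => (p * ij.1, p * ij.2)) ?_ ?_ ?_ fun _ _ => rfl
  · rintro ⟨a, b⟩ - ⟨c, d⟩ - h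
    simpa [hp.ne'] using h
  · rintro ⟨a, b⟩ h
    simp only [Finset.mem_coe, Finset.HasAntidiagonal.mem_antidiagonal] at h ⊢
    rw [← h, mul_add]
  · rintro ⟨a, b⟩ h hnot
    rw [Finset.HasAntidiagonal.mem_antidiagonal] at h
    simp only at h
    by_cases hb : p ∣ b
    · obtain ⟨d, rfl⟩ := hb
      obtain ⟨c, rfl⟩ : p ∣ a := (Nat.dvd_add_left ⟨d, rfl⟩).1 (h ▸ ⟨n, rfl⟩)
      refine absurd ⟨(c, d), ?_, rfl⟩ hnot
      rw [Finset.mem_coe, Finset.HasAntidiagonal.mem_antidiagonal]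
      rw [← mul_add] at h
      exact Nat.eq_of_mul_eq_mul_left hp h
    · simp [hg b hb]

/-- The generating series, in the variable `z ^ p`, of a labeled class supported in sizes
divisible by `p`. -/
noncomputable def contractedSeries (X : ℕ → Type) (p : ℕ) : ℝ⟦X⟧ :=
  PowerSeries.mk fun n => PowerSeries.coeff (p * n) (countingSeries X)

lemma coeff_contractedSeries (X : ℕ → Type) (p n : ℕ) :
    PowerSeries.coeff n (contractedSeries X p) = (Nat.card (X (p * n)) : ℝ) / ((p * n)! : ℝ) := by
  rw [contractedSeries, PowerSeries.coeff_mk, countingSeries, PowerSeries.coeff_mk]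

/-- The inverse of the generating series, in the variable `z ^ p`. -/
noncomputable def contractedInverse (X : ℕ → Type) (p : ℕ) : ℝ⟦X⟧ :=
  PowerSeries.mk fun n => PowerSeries.coeff (p * n) (countingSeries X)⁻¹

lemma contractedSeries_mul_inverse {X : ℕ → Type} {p : ℕ} (hp : 0 < p)
    (h0 : Nat.card (X 0) = 1) (hX : ∀ m, ¬ p ∣ m → Nat.card (X m) = 0) :
    contractedSeries X p * contractedInverse X p = 1 := by
  have hA : (countingSeries X)⁻¹ * countingSeries X = 1 := by
    refine PowerSeries.inv_mul_cancel _ ?_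
    rw [← PowerSeries.coeff_zero_eq_constantCoeff_apply, countingSeries, PowerSeries.coeff_mk, h0]
    simp
  rw [mul_comm]
  ext n
  rw [PowerSeries.coeff_mul]
  simp only [contractedSeries, contractedInverse, PowerSeries.coeff_mk]
  rw [← sum_antidiagonal_mul_of_dvd hp
    (fun i => PowerSeries.coeff i (countingSeries X)⁻¹)
    (fun j => PowerSeries.coeff j (countingSeries X)), ← PowerSeries.coeff_mul, hA,
    PowerSeries.coeff_one, PowerSeries.coeff_one]
  · simp [hp.ne']
  · intro j hj
    simp [countingSeries, hX j hj]

/-- Divided by `m!`, the recurrence is `θA = θC · A` coefficientwise. Passing to the variable `z ^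
p` divides both Euler derivatives by `p`, so the identity persists. -/
lemma eulerOp_contractedSeries {X : ℕ → Type} {p : ℕ} (hp : 0 < p)
    (hX : ∀ m, ¬ p ∣ m → Nat.card (X m) = 0) {conn : ℕ → ℕ}
    (hrec : ∀ m, m * Nat.card (X m) = ∑ k ∈ Finset.range (m + 1), m.choose k *
      (k * (conn k * Nat.card (X (m - k))))) :
    eulerOp (contractedSeries X p) =
      eulerOp (PowerSeries.mk fun n => (conn (p * n) : ℝ) / ((p * n)! : ℝ)) *
        contractedSeries X p := by
  ext n
  have h1 : ((p * n : ℕ) : ℝ) * ((Nat.card (X (p * n)) : ℝ) / ((p * n)! : ℝ)) =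
      ∑ ij ∈ Finset.HasAntidiagonal.antidiagonal (p * n),
        ((ij.1 : ℝ) * ((conn ij.1 : ℝ) / (ij.1 ! : ℝ))) *
          ((Nat.card (X ij.2) : ℝ) / (ij.2 ! : ℝ)) := by
    rw [← mul_div_assoc, ← Nat.cast_mul, hrec, Finset.Nat.sum_antidiagonal_eq_sum_range_succ
      (fun i j => ((i : ℝ) * ((conn i : ℝ) / (i ! : ℝ))) * ((Nat.card (X j) : ℝ) / (j ! : ℝ)))]
    push_cast
    rw [Finset.sum_div]
    refine Finset.sum_congr rfl fun k hk => ?_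
    rw [Nat.cast_choose ℝ (by have := Finset.mem_range.1 hk; omega)]
    have e1 : ((p * n)! : ℝ) ≠ 0 := by positivity
    have e2 : (k ! : ℝ) ≠ 0 := by positivity
    have e3 : ((p * n - k)! : ℝ) ≠ 0 := by positivity
    field_simp
  rw [sum_antidiagonal_mul_of_dvd hp (fun i => (i : ℝ) * ((conn i : ℝ) / (i ! : ℝ)))
    (fun j => (Nat.card (X j) : ℝ) / (j ! : ℝ)) fun j hj => by simp [hX j hj]] at h1
  rw [coeff_eulerOp, PowerSeries.coeff_mul, coeff_contractedSeries]
  simp only [coeff_eulerOp, coeff_contractedSeries, PowerSeries.coeff_mk]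
  have hp' : (p : ℝ) ≠ 0 := by exact_mod_cast hp.ne'
  refine mul_left_cancel₀ hp' ?_
  rw [← mul_assoc, ← Nat.cast_mul, h1, Finset.mul_sum]
  refine Finset.sum_congr rfl fun ij _ => ?_
  push_cast; ring

/-- The binomial coefficient turns counts into exponential coefficients, and the sign in `1 - 1/A`
cancels the one in `derivativeTerm`. For `k = 0` the constant term `1` of the inverse plays the role
of the leading `1`. -/
lemma derivativeTerm_eq {X : ℕ → Type} {p : ℕ} (hp : 0 < p) (h0 : Nat.card (X 0) = 1)
    {k n : ℕ} (hX : Nat.card (X (p * n)) ≠ 0) (hkn : k ≤ n) :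
    derivativeTerm X p k n = PowerSeries.coeff k (contractedInverse X p) *
      (PowerSeries.coeff (n - k) (contractedSeries X p) /
        PowerSeries.coeff n (contractedSeries X p)) := by
  have e1 : ((p * n)! : ℝ) ≠ 0 := by positivity
  have e0 : (Nat.card (X (p * n)) : ℝ) ≠ 0 := by exact_mod_cast hX
  rw [derivativeTerm, contractedInverse, PowerSeries.coeff_mk, coeff_contractedSeries,
    coeff_contractedSeries]
  split_ifs with hk
  · subst hk
    rw [mul_zero, PowerSeries.coeff_zero_eq_constantCoeff_apply, PowerSeries.constantCoeff_inv,
      ← PowerSeries.coeff_zero_eq_constantCoeff_apply, countingSeries, PowerSeries.coeff_mk, h0,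
      Nat.sub_zero]
    field_simp
    simp
  · have hpk : p * k ≠ 0 := mul_ne_zero hp.ne' hk
    have hle : p * k ≤ p * n := Nat.mul_le_mul_left p hkn
    rw [derivativeSeq, map_sub, PowerSeries.coeff_one, if_neg hpk, Nat.cast_choose ℝ hle,
      Nat.mul_sub]
    have e2 : ((p * k)! : ℝ) ≠ 0 := by positivity
    have e3 : ((p * n - p * k)! : ℝ) ≠ 0 := by positivity
    field_simp
    ring

/-- Both asymptotic expansions of the probability of connectedness, for classes of colored
matchings whose counting sequence has rational ratios. -/
theorem connectedProb_expansions {Q ι : Type} [Finite Q] (κ : Q → ι) {X : ℕ → Type} {p : ℕ}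
    (hp : 0 < p) (hcard : ∀ m, Nat.card (X m) = matchingCount κ m)
    (hX : ∀ m, ¬ p ∣ m → Nat.card (X m) = 0) {c α β γ : ℝ} {s : ℕ}
    (h : HasRationalRatio (contractedSeries X p) c α β γ s) {prob : ℕ → ℝ}
    (hprob : ∀ n, prob n =
      (connectedMatchingCount κ (p * n) : ℝ) / (Nat.card (X (p * n)) : ℝ)) :
    contractedSeries X p * contractedInverse X p = 1 ∧
      HasAsympExpansion prob (derivativeTerm X p) ∧
      HasInvExpansion prob
        (PowerSeries.mk (connectedCoeff (contractedInverse X p) c α β γ s)) := by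
  have h0 : Nat.card (X 0) = 1 := by
    have := h.coeff_zero
    rw [coeff_contractedSeries, mul_zero, Nat.factorial_zero, Nat.cast_one, div_one] at this
    exact_mod_cast this
  have hAB := contractedSeries_mul_inverse hp h0 hX
  have hC := eulerOp_contractedSeries hp hX (conn := connectedMatchingCount κ) fun m => by
    simp only [hcard]
    exact mul_matchingCount κ m
  have hCle : ∀ n, |PowerSeries.coeff n (PowerSeries.mk fun n =>
      (connectedMatchingCount κ (p * n) : ℝ) / ((p * n)! : ℝ))| ≤
      PowerSeries.coeff n (contractedSeries X p) := fun n => by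
    rw [PowerSeries.coeff_mk, coeff_contractedSeries, abs_of_nonneg (by positivity), hcard]
    gcongr
    exact connectedMatchingCount_le κ _
  have hpr : prob = fun n => PowerSeries.coeff n (PowerSeries.mk fun n =>
      (connectedMatchingCount κ (p * n) : ℝ) / ((p * n)! : ℝ)) /
      PowerSeries.coeff n (contractedSeries X p) := funext fun n => by
    rw [hprob, PowerSeries.coeff_mk, coeff_contractedSeries,
      div_div_div_cancel_right₀ (by positivity)]
  rw [hpr]
  refine ⟨hAB, h.hasAsympExpansion_shift hAB hC hCle fun k n hkn => ?_,
    h.hasInvExpansion_connected hAB hC hCle⟩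
  refine derivativeTerm_eq hp h0 (fun h1 => ?_) hkn
  have := h.rapidGrowth.pos n
  rw [coeff_contractedSeries, h1] at this
  simp at this

theorem connectedProb_expansion_linear {B A : ℝ⟦X⟧} {c α β γ : ℝ} {prob : ℕ → ℝ}
    (h : HasRationalRatio A c α β γ 0) (hAB : A * B = 1)
    (hexp : HasInvExpansion prob (PowerSeries.mk (connectedCoeff B c α β γ 0))) :
    HasAsympExpansion prob fun k n => connectedCoeff B c α β γ 0 k / (n : ℝ) ^ k :=
  hexp.hasAsympExpansion fun k => by
    rcases k with _ | k
    · rw [h.connectedCoeff_zero hAB]; exact one_ne_zero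
    · exact (h.connectedCoeff_neg hAB (by omega)).ne

theorem connectedProb_expansion_quadratic {B A : ℝ⟦X⟧} {c α β γ : ℝ} {prob : ℕ → ℝ}
    (h : HasRationalRatio A c α β γ 1) (hAB : A * B = 1)
    (hexp : HasInvExpansion prob (PowerSeries.mk (connectedCoeff B c α β γ 1))) :
    HasAsympExpansion prob fun k n => if k = 0 then connectedCoeff B c α β γ 1 0
      else connectedCoeff B c α β γ 1 (k + 1) / (n : ℝ) ^ (k + 1) :=
  hexp.hasAsympExpansion_skip (by rw [h.connectedCoeff_zero hAB]; exact one_ne_zero)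
    (HasRationalRatio.connectedCoeff_eq_zero (by norm_num) (by norm_num))
    fun k => (h.connectedCoeff_neg hAB (by omega)).ne

/-! ### The four models -/

lemma doubleFactorial_odd_succ (n : ℕ) : (2 * (n + 1) - 1)‼ = (2 * n + 1) * (2 * n - 1)‼ := by
  rw [show 2 * (n + 1) - 1 = 2 * n + 1 by omega, Nat.doubleFactorial_add_one]

/-- Gluings of polygons are matchings with a single color. -/
def PolygonGluing.equivColoredMatching (p n : ℕ) :
    PolygonGluing p n ≃ ColoredMatching fun _ : Fin n × Fin p => () :=
  Equiv.subtypeEquivRight fun α => by simp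

/-- Quadratic square-tiled surfaces are matchings preserving the direction of the sides. -/
def QuadraticSquareTiledSurface.equivColoredMatching (n : ℕ) :
    QuadraticSquareTiledSurface n ≃ ColoredMatching fun t : Fin n × Fin 4 => (t.2 : ℕ) % 2 :=
  Equiv.subtypeSubtypeEquivSubtypeInter _
    (fun α : Equiv.Perm (Fin n × Fin 4) => ∀ s, ((α s).2 : ℕ) % 2 = (s.2 : ℕ) % 2)

lemma card_polygonGluing_even {p n k : ℕ} (h : n * p = 2 * k) :
    Nat.card (PolygonGluing p n) = (2 * k - 1)‼ :=
  card_perfectMatching_even (by simpa using h)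

lemma card_polygonGluing_odd {p n : ℕ} (h : Odd (n * p)) : Nat.card (PolygonGluing p n) = 0 :=
  card_perfectMatching_odd (by simpa using h)

lemma card_coloredMatching_constant {T ι : Type} [Finite T] {κ : T → ι}
    (hκ : ∀ t t', κ t = κ t') {k : ℕ} (h : Nat.card T = 2 * k) :
    Nat.card (ColoredMatching κ) = (2 * k - 1)‼ := by
  rw [← card_perfectMatching_even h]
  exact Nat.card_congr (Equiv.subtypeEquivRight fun α => by simp [fun t => hκ (α t) t])

lemma card_quadraticSquareTiledSurface (n : ℕ) :
    Nat.card (QuadraticSquareTiledSurface n) = ((2 * n - 1)‼) ^ 2 := by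
  rw [Nat.card_congr (QuadraticSquareTiledSurface.equivColoredMatching n)]
  have hcard : ∀ P : Fin 4 → Prop, Nat.card {q // P q} = 2 →
      Nat.card {t : Fin n × Fin 4 // P t.2} = 2 * n := by
    intro P hP
    have e : {t : Fin n × Fin 4 // P t.2} ≃ Fin n × {q // P q} :=
      ⟨fun t => (t.1.1, ⟨t.1.2, t.2⟩), fun t => ⟨(t.1, t.2.1), t.2.2⟩, fun _ => rfl, fun _ => rfl⟩
    rw [Nat.card_congr e, Nat.card_prod, hP, Nat.card_fin, mul_comm]
  -- Color preservation makes the set of horizontal sides closed automatically, so every matching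
  -- splits into one of the `2n` horizontal and one of the `2n` vertical sides.
  have e1 : (ColoredMatching fun t : Fin n × Fin 4 => (t.2 : ℕ) % 2) ≃
      {x : ColoredMatching fun t : Fin n × Fin 4 => (t.2 : ℕ) % 2 //
        ∀ t, (t.2 : ℕ) % 2 = 0 → ((x.1 t).2 : ℕ) % 2 = 0} :=
    (Equiv.subtypeUnivEquiv fun x t ht => (x.2.2 t).trans ht).symm
  rw [Nat.card_congr (e1.trans (ColoredMatching.split _ fun t : Fin n × Fin 4 => (t.2 : ℕ) % 2 = 0)), Nat.card_prod,
    card_coloredMatching_constant (k := n) _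
      (hcard (fun q => (q : ℕ) % 2 = 0) (by rw [Nat.card_eq_fintype_card]; rfl)),
    card_coloredMatching_constant (k := n) _
      (hcard (fun q => ¬ (q : ℕ) % 2 = 0) (by rw [Nat.card_eq_fintype_card]; rfl)), sq]
  · rintro ⟨t, ht⟩ ⟨t', ht'⟩
    simp only
    omega
  · rintro ⟨t, ht⟩ ⟨t', ht'⟩
    simp only
    omega

lemma card_gem_even (D n : ℕ) : Nat.card (GEM D (2 * n)) = ((2 * n - 1)‼) ^ (D + 1) := by
  have h : Nat.card {α : Equiv.Perm (Fin (2 * n)) // IsPerfectMatching α} = (2 * n - 1)‼ :=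
    card_perfectMatching_even (by simp)
  rw [GEM, Nat.card_fun, h, Nat.card_fin]

lemma card_gem_odd (D n : ℕ) : Nat.card (GEM D (2 * n + 1)) = 0 := by
  have h : Nat.card {α : Equiv.Perm (Fin (2 * n + 1)) // IsPerfectMatching α} = 0 :=
    card_perfectMatching_odd (by simp)
  rw [GEM, Nat.card_fun, h, Nat.card_fin, zero_pow (by omega)]

lemma card_triangulatedSurface_even (n : ℕ) :
    Nat.card (TriangulatedSurface (2 * n)) = (6 * n - 1)‼ := by
  rw [card_polygonGluing_even (k := 3 * n) (by ring), ← mul_assoc]; rfl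

lemma card_triangulatedSurface_odd (n : ℕ) : Nat.card (TriangulatedSurface (2 * n + 1)) = 0 :=
  card_polygonGluing_odd ⟨3 * n + 1, by ring⟩

lemma card_quadrangulatedSurface (n : ℕ) :
    Nat.card (QuadrangulatedSurface n) = (4 * n - 1)‼ := by
  rw [card_polygonGluing_even (k := 2 * n) (by ring), ← mul_assoc]; rfl

lemma eq_zero_of_not_two_dvd {f : ℕ → ℕ} (h : ∀ n, f (2 * n + 1) = 0) (m : ℕ) (hm : ¬ 2 ∣ m) :
    f m = 0 := by
  obtain ⟨n, rfl⟩ : Odd m := by rwa [← Nat.not_even_iff_odd, even_iff_two_dvd]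
  exact h n

/-- The ratio is `(6n+5)(6n+3)(6n+1) / ((2n+2)(2n+1)) = 54 (n+5/6)(n+1/6) / (n+1)`. Since `s = 0`,
the value of `γ` is a placeholder. -/
lemma hasRationalRatio_triangulated :
    HasRationalRatio (contractedSeries TriangulatedSurface 2) (1 / 54) (1 / 6) (5 / 6) (1 / 2) 0 := by
  refine ⟨?_, by norm_num, by norm_num, by norm_num, by norm_num, by norm_num, by norm_num,
    by norm_num, fun n => ?_⟩
  · rw [coeff_contractedSeries, card_triangulatedSurface_even]; simp
  · have e1 : (6 * (n + 1) - 1)‼ = (6 * n + 5) * ((6 * n + 3) * ((6 * n + 1) * (6 * n - 1)‼)) := by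
      rw [show 6 * (n + 1) - 1 = 2 * (3 * n + 2 + 1) - 1 by omega, doubleFactorial_odd_succ,
        doubleFactorial_odd_succ, doubleFactorial_odd_succ]
      ring_nf
    rw [coeff_contractedSeries, coeff_contractedSeries, card_triangulatedSurface_even,
      card_triangulatedSurface_even, e1, show 2 * (n + 1) = 2 * n + 1 + 1 by ring,
      Nat.factorial_succ, Nat.factorial_succ]
    have e2 : ((2 * n)! : ℝ) ≠ 0 := by positivity
    push_cast
    field_simp
    ring

lemma hasRationalRatio_quadrangulated :
    HasRationalRatio (contractedSeries QuadrangulatedSurface 1)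
      (1 / 16) (1 / 4) (3 / 4) (1 / 2) 0 := by
  refine ⟨?_, by norm_num, by norm_num, by norm_num, by norm_num, by norm_num, by norm_num,
    by norm_num, fun n => ?_⟩
  · rw [coeff_contractedSeries, card_quadrangulatedSurface]; simp
  · have e1 : (4 * (n + 1) - 1)‼ = (4 * n + 3) * ((4 * n + 1) * (4 * n - 1)‼) := by
      rw [show 4 * (n + 1) - 1 = 2 * (2 * n + 1 + 1) - 1 by omega, doubleFactorial_odd_succ,
        doubleFactorial_odd_succ]
      ring_nf
    simp only [coeff_contractedSeries, one_mul, card_quadrangulatedSurface, e1,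
      Nat.factorial_succ]
    have e2 : (n ! : ℝ) ≠ 0 := by positivity
    push_cast
    field_simp
    ring

lemma hasRationalRatio_squareTiled :
    HasRationalRatio (contractedSeries QuadraticSquareTiledSurface 1)
      (1 / 4) (1 / 2) (1 / 2) (1 / 2) 0 := by
  refine ⟨?_, by norm_num, by norm_num, by norm_num, by norm_num, by norm_num, by norm_num,
    by norm_num, fun n => ?_⟩
  · rw [coeff_contractedSeries, card_quadraticSquareTiledSurface]; simp
  · simp only [coeff_contractedSeries, one_mul, card_quadraticSquareTiledSurface,
      doubleFactorial_odd_succ, Nat.factorial_succ]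
    have e2 : (n ! : ℝ) ≠ 0 := by positivity
    push_cast
    field_simp
    ring

/-- One of the four factors `2n+1` cancels against `(2n+2)!`, leaving the ratio `4 (n+1/2)^3 /
(n+1)`; the third factor is the reason for `s = 1` and for the missing term in `1/n`. -/
lemma hasRationalRatio_gem :
    HasRationalRatio (contractedSeries (GEM 3) 2) (1 / 4) (1 / 2) (1 / 2) (1 / 2) 1 := by
  refine ⟨?_, by norm_num, by norm_num, by norm_num, by norm_num, by norm_num, by norm_num,
    by norm_num, fun n => ?_⟩
  · rw [coeff_contractedSeries, card_gem_even]; simp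
  · rw [coeff_contractedSeries, coeff_contractedSeries, card_gem_even, card_gem_even,
      doubleFactorial_odd_succ, show 2 * (n + 1) = 2 * n + 1 + 1 by ring, Nat.factorial_succ,
      Nat.factorial_succ]
    have e2 : ((2 * n)! : ℝ) ≠ 0 := by positivity
    push_cast
    field_simp
    ring

lemma polygonGluing_connectedProb (p m : ℕ) :
    uniformProb (PolygonGluing p m) (fun α => ConnectedSpace (GluedSurface α.1)) =
      (connectedMatchingCount (fun _ : Fin p => ()) m : ℝ) / (Nat.card (PolygonGluing p m) : ℝ) := by
  exact congrArg (fun k : ℕ => (k : ℝ) / (Nat.card (PolygonGluing p m) : ℝ)) (Nat.card_congr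
    (Equiv.subtypeEquiv (q := fun x => IsConnectedMatching Prod.fst x.1)
      (PolygonGluing.equivColoredMatching p m) fun α => connectedSpace_gluedSurface_iff α.2))

lemma squareTiledConnectedProb_eq (m : ℕ) :
    squareTiledConnectedProb m = (connectedMatchingCount (fun q : Fin 4 => (q : ℕ) % 2) m : ℝ) /
      (Nat.card (QuadraticSquareTiledSurface m) : ℝ) := by
  exact congrArg (fun k : ℕ => (k : ℝ) / (Nat.card (QuadraticSquareTiledSurface m) : ℝ))
    (Nat.card_congr (Equiv.subtypeEquiv (q := fun x => IsConnectedMatching Prod.fst x.1)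
      (QuadraticSquareTiledSurface.equivColoredMatching m)
      fun α => connectedSpace_gluedSurface_iff α.1.2))

lemma gemConnectedProb_eq {D : ℕ} (hD : 0 < D) (m : ℕ) :
    gemConnectedProb D m = (connectedMatchingCount (fun q : Fin (D + 1) => q) m : ℝ) /
      (Nat.card (GEM D m) : ℝ) := by
  exact congrArg (fun k : ℕ => (k : ℝ) / (Nat.card (GEM D m) : ℝ))
    (Nat.card_congr (Equiv.subtypeEquiv (q := fun x => IsConnectedMatching Prod.fst x.1)
      (GEM.equivColoredMatching D m) fun g => g.connectedSpace_iff hD))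

theorem mainTheorem12 :
    -- triangulated surfaces, made of `2 * n` triangles
    ((∀ n : ℕ, Nat.card (TriangulatedSurface (2 * n)) = (6 * n - 1)‼ ∧
          Nat.card (TriangulatedSurface (2 * n + 1)) = 0) ∧
      HasAsympExpansion (fun n => triangulatedConnectedProb (2 * n))
        (derivativeTerm TriangulatedSurface 2) ∧
      ∃ e : ℕ → ℝ, e 0 = 1 ∧ e 1 = -(5 / 36) ∧ e 2 = -(695 / 2592) ∧ e 3 = -(216305 / 279936) ∧
        HasAsympExpansion (fun n => triangulatedConnectedProb (2 * n))
          (fun k n => e k / (n : ℝ) ^ k)) ∧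
    -- quadrangulated surfaces, made of `n` quadrilaterals
    ((∀ n : ℕ, Nat.card (QuadrangulatedSurface n) = (4 * n - 1)‼) ∧
      HasAsympExpansion (fun n => quadrangulatedConnectedProb n)
        (derivativeTerm QuadrangulatedSurface 1) ∧
      ∃ e : ℕ → ℝ, e 0 = 1 ∧ e 1 = -(3 / 16) ∧ e 2 = -(183 / 512) ∧ e 3 = -(8313 / 8192) ∧
        HasAsympExpansion (fun n => quadrangulatedConnectedProb n)
          (fun k n => e k / (n : ℝ) ^ k)) ∧
    -- quadratic square-tiled surfaces, made of `n` squares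
    ((∀ n : ℕ, Nat.card (QuadraticSquareTiledSurface n) = ((2 * n - 1)‼) ^ 2) ∧
      HasAsympExpansion (fun n => squareTiledConnectedProb n)
        (derivativeTerm QuadraticSquareTiledSurface 1) ∧
      ∃ e : ℕ → ℝ, e 0 = 1 ∧ e 1 = -(1 / 4) ∧ e 2 = -(15 / 32) ∧ e 3 = -(167 / 128) ∧
        e 4 = -(11845 / 2048) ∧
        HasAsympExpansion (fun n => squareTiledConnectedProb n)
          (fun k n => e k / (n : ℝ) ^ k)) ∧
    -- graph encoded manifolds of dimension 3, made of `2 * n` tetrahedra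
    ((∀ n : ℕ, Nat.card (GEM 3 (2 * n)) = ((2 * n - 1)‼) ^ 4 ∧
          Nat.card (GEM 3 (2 * n + 1)) = 0) ∧
      HasAsympExpansion (fun n => gemConnectedProb 3 (2 * n)) (derivativeTerm (GEM 3) 2) ∧
      ∃ e : ℕ → ℝ, e 0 = 1 ∧ e 2 = -(1 / 8) ∧ e 3 = -(3 / 16) ∧ e 4 = -(49 / 128) ∧
        e 5 = -(145 / 128) ∧
        HasAsympExpansion (fun n => gemConnectedProb 3 (2 * n))
          (fun k n => if k = 0 then e 0 else e (k + 1) / (n : ℝ) ^ (k + 1))) := by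
  refine ⟨⟨fun n => ⟨card_triangulatedSurface_even n, card_triangulatedSurface_odd n⟩, ?_⟩,
    ⟨card_quadrangulatedSurface, ?_⟩, ⟨card_quadraticSquareTiledSurface, ?_⟩,
    ⟨fun n => ⟨card_gem_even 3 n, card_gem_odd 3 n⟩, ?_⟩⟩
  · have h := hasRationalRatio_triangulated
    obtain ⟨hAB, h1, h2⟩ := connectedProb_expansions (fun _ : Fin 3 => ()) two_pos
      (fun m => Nat.card_congr (PolygonGluing.equivColoredMatching 3 m))
      (eq_zero_of_not_two_dvd card_triangulatedSurface_odd) h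
      (fun n => polygonGluing_connectedProb 3 (2 * n))
    obtain ⟨v1, v2, v3⟩ := connectedCoeff_triangulated h hAB
    exact ⟨h1, _, h.connectedCoeff_zero hAB, v1, v2, v3, connectedProb_expansion_linear h hAB h2⟩
  · have h := hasRationalRatio_quadrangulated
    obtain ⟨hAB, h1, h2⟩ := connectedProb_expansions (fun _ : Fin 4 => ()) one_pos
      (fun m => Nat.card_congr (PolygonGluing.equivColoredMatching 4 m))
      (fun m hm => absurd (one_dvd m) hm) h
      (prob := fun n => quadrangulatedConnectedProb n)
      (fun n => by rw [one_mul]; exact polygonGluing_connectedProb 4 n)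
    obtain ⟨v1, v2, v3⟩ := connectedCoeff_quadrangulated h hAB
    exact ⟨h1, _, h.connectedCoeff_zero hAB, v1, v2, v3, connectedProb_expansion_linear h hAB h2⟩
  · have h := hasRationalRatio_squareTiled
    obtain ⟨hAB, h1, h2⟩ := connectedProb_expansions (fun q : Fin 4 => (q : ℕ) % 2) one_pos
      (fun m => Nat.card_congr (QuadraticSquareTiledSurface.equivColoredMatching m))
      (fun m hm => absurd (one_dvd m) hm) h
      (prob := fun n => squareTiledConnectedProb n)
      (fun n => by rw [one_mul]; exact squareTiledConnectedProb_eq n)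
    obtain ⟨v1, v2, v3, v4⟩ := connectedCoeff_squareTiled h hAB
    exact ⟨h1, _, h.connectedCoeff_zero hAB, v1, v2, v3, v4,
      connectedProb_expansion_linear h hAB h2⟩
  · have h := hasRationalRatio_gem
    obtain ⟨hAB, h1, h2⟩ := connectedProb_expansions (fun q : Fin 4 => q) two_pos
      (fun m => Nat.card_congr (GEM.equivColoredMatching 3 m))
      (eq_zero_of_not_two_dvd (card_gem_odd 3)) h
      (fun n => gemConnectedProb_eq (by norm_num) (2 * n))
    obtain ⟨v2, v3, v4, v5⟩ := connectedCoeff_gem h hAB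
    exact ⟨h1, _, h.connectedCoeff_zero hAB, v2, v3, v4, v5,
      connectedProb_expansion_quadratic h hAB h2⟩
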